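/- Setting. Let $\alpha\in(0,1)$. For every $m\ge 2$ let $p_{1,m},\dots,p_{m,m}$ be $[0,1]$-valued random variables ($p$-values) on a probability space $(\Omega_m,\mathcal A_m,P_m)$, and let $I_{0,m}\subseteq\{1,\dots,m\}$ be a nonrandom set (the true null hypotheses) with complement $I_{1,m}$, such that $m_0:=\#I_{0,m}\ge 1$; put $m_1:=\#I_{1,m}$. Assume basic independence: the vectors $(p_{i,m})_{i\in I_{0,m}}$ and $(p_{i,m})_{i\in I_{1,m}}$ are independent, and the $p_{i,m}$, $i\in I_{0,m}$, are independent and uniformly distributed on $[0,1]$ (the dependence among the $p_{i,m}$, $i\in I_{1,m}$, is arbitrary). Assume $m_0/m\to\kappa_0\in(0,1]$ as $m\to\infty$. Let $(a_m)$, $(b_m)$ be real sequences with $b_m/m\to0$ such that for every $m$ either $b_m>0$ and $a_m\in[0,1-\alpha]$, or $b_m=0$ and $a_m\in[0,1-\alpha)$. Consider the step-up test with the deterministic critical values $$\alpha_{i:m}=\frac{i\alpha}{m+b_m-a_m i},\qquad 0\le i\le m.$$ With the ordered $p$-values $p_{1:m}\le\dots\le p_{m:m}$ and $p_{0:m}:=0$,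 let $R_m=\max\{i\in\{0,\dots,m\}:p_{i:m}\le\alpha_{i:m}\}$ be the number of rejections, $V_m=\#\{i\in I_{0,m}:p_{i,m}\le\alpha_{R_m:m}\}$ the number of false rejections, and $\mathrm{FDP}_m=V_m/R_m$ with $0/0=0$. For $j=1,2$ let $R_m^{(j,1)}$ be the number of rejections of the same test when the $p$-values of the $j$ smallest indices in $I_{0,m}$ (of all of $I_{0,m}$ if $m_0<j$) are replaced by $0$. The test is called consistent if $\mathrm{FDP}_m-E(\mathrm{FDP}_m)\to0$ in $P_m$-probability. Lemma. (a) The test is consistent if and only if the following three conditions hold in $P_m$-probability: $$R_m^{(1,1)}\to\infty,\tag{1}$$ $$\frac{a_m}{m}\Bigl(R_m^{(2,1)}-R_m^{(1,1)}\Bigr)\to0,\tag{2}$$ $$\frac{m+b_m-a_mR_m^{(1,1)}}{m_0}-E\Bigl(\frac{m+b_m-a_mR_m^{(1,1)}}{m_0}\Bigr)\to0.\tag{3}$$ (b) If $\kappa_0=1$, $m_1\to\infty$ and $\limsup_{m\to\infty}a_m<1-\alpha$, then (1) alone is sufficient for consistency, and moreover $E(\mathrm{FDP}_m)\to\alpha$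 (whether or not (1) holds). -/

import Mathlib

open MeasureTheory ProbabilityTheory Filter
open scoped Topology

namespace StepUp

/-- The ordered `p`-values `p_{1:m} ≤ … ≤ p_{m:m}`, together with `p_{0:m} = 0`
(indices `i > m`, which are never used, get the value `0`). -/
noncomputable def orderedPValue {m : ℕ} (p : Fin m → ℝ) (i : ℕ) : ℝ :=
  if h : 0 < i ∧ i ≤ m then p (Tuple.sort p ⟨i - 1, by omega⟩) else 0

/-- The number of rejections `R = max {i = 0, …, m : p_{i:m} ≤ α_{i:m}}` of the step-up test with
critical values `crit i = α_{i:m}`, where `crit 0 = 0`. -/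
noncomputable def numRejections {m : ℕ} (crit : ℕ → ℝ) (p : Fin m → ℝ) : ℕ :=
  ((Finset.range (m + 1)).filter fun i => orderedPValue p i ≤ crit i).sup id

/-- The number of false rejections `V`: hypothesis `i` is rejected iff `p_i ≤ α_{R:m}`, and the
rejection is false iff `i` is a true null hypothesis, `i ∈ I₀`. -/
noncomputable def numFalseRejections {m : ℕ} (crit : ℕ → ℝ) (I₀ : Finset (Fin m))
    (p : Fin m → ℝ) : ℕ :=
  (I₀.filter fun i => p i ≤ crit (numRejections crit p)).card

/-- The false discovery proportion `V / R`, with `0 / 0 = 0`. -/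
noncomputable def fdp {m : ℕ} (crit : ℕ → ℝ) (I₀ : Finset (Fin m)) (p : Fin m → ℝ) : ℝ :=
  (numFalseRejections crit I₀ p : ℝ) / (numRejections crit p : ℝ)

/-- The vector `p^{(j,1)}`: the `p`-values of the `j` true null hypotheses with the smallest
indices are replaced by `0` (all those of the true nulls if there are fewer than `j`). -/
noncomputable def substPValues {m : ℕ} (I₀ : Finset (Fin m)) (j : ℕ) (p : Fin m → ℝ) :
    Fin m → ℝ :=
  fun i => if i ∈ I₀ ∧ (I₀.filter fun k => k < i).card < j then 0 else p i

/-- `R^{(j,1)}`: the number of rejections for the substituted vector `p^{(j,1)}`. -/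
noncomputable def numRejectionsSubst {m : ℕ} (crit : ℕ → ℝ) (I₀ : Finset (Fin m)) (j : ℕ)
    (p : Fin m → ℝ) : ℕ :=
  numRejections crit (substPValues I₀ j p)

/-- The critical values `α_{i:m} = i α / (m + b - a i)`. -/
noncomputable def critVal (α a b : ℝ) (m i : ℕ) : ℝ :=
  (i : ℝ) * α / ((m : ℝ) + b - a * (i : ℝ))

/-- The admissible parameters: `b > 0` and `a ∈ [0, 1 - α]`, or `b = 0` and `a ∈ [0, 1 - α)`. -/
def AdmissibleParams (α a b : ℝ) : Prop :=
  (0 < b ∧ a ∈ Set.Icc 0 (1 - α)) ∨ (b = 0 ∧ a ∈ Set.Ico 0 (1 - α))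

/-- The basic independence model with `p`-values `p i` in `[0, 1]` and (nonrandom, nonempty) set
`I₀` of true null hypotheses. -/
structure BasicIndependence {Ω : Type*} [MeasurableSpace Ω] (P : Measure Ω) {m : ℕ}
    (p : Fin m → Ω → ℝ) (I₀ : Finset (Fin m)) : Prop where
  nonempty_trueNulls : I₀.Nonempty
  measurable : ∀ i, Measurable (p i)
  mem_Icc : ∀ i ω, p i ω ∈ Set.Icc (0 : ℝ) 1
  indep_true_false :
    IndepFun (fun ω (i : {i : Fin m // i ∈ I₀}) => p i ω)
      (fun ω (i : {i : Fin m // i ∉ I₀}) => p i ω) P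
  indep_true : iIndepFun (fun i : {i : Fin m // i ∈ I₀} => p i) P
  uniform_true : ∀ i ∈ I₀, ∀ x ∈ Set.Icc (0 : ℝ) 1, P {ω | p i ω ≤ x} = ENNReal.ofReal x

/-- `X_m → c` in `P_m`-probability, where `X_m` lives on its own space `(Ω_m, P_m)`. -/
def TendstoInProb {Ω : ℕ → Type*} [∀ m, MeasurableSpace (Ω m)] (P : ∀ m, Measure (Ω m))
    (X : ∀ m, Ω m → ℝ) (c : ℝ) : Prop :=
  ∀ ε : ℝ, 0 < ε → Tendsto (fun m => P m {ω | ε ≤ |X m ω - c|}) atTop (𝓝 0)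

/-- `X_m → ∞` in `P_m`-probability, where `X_m` lives on its own space `(Ω_m, P_m)`. -/
def TendstoInProbAtTop {Ω : ℕ → Type*} [∀ m, MeasurableSpace (Ω m)] (P : ∀ m, Measure (Ω m))
    (X : ∀ m, Ω m → ℝ) : Prop :=
  ∀ K : ℝ, Tendsto (fun m => P m {ω | X m ω ≤ K}) atTop (𝓝 0)

end StepUp

/-! Write `R_j` for the number of rejections after zeroing the `j` first true `p`-values, and `ζ_j =
(m + b - a R_j) / m₀`. Everything rests on a leave-one-out identity. Zeroing a true `p_i` changes
neither whether `p_i` lies below the rejection threshold nor, if it does, the number of rejections.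
The new threshold no longer involves `p_i`, so the uniform variable `p_i` can be integrated out and
contributes the threshold itself as a factor. Summing over exchangeable nulls gives `E(V g(R)) = m₀
E(c(R_1) g(R_1))`. For the present critical values `m₀ c(r) / r = α / ζ(r)`, whence `E(FDP) = α
E(1/ζ_1)`.

Doing the same for pairs of nulls gives the second moment, and then `Var(FDP) = α E(1/(ζ_1 R_1)) +
α² E(ζ_2⁻² - ζ_1⁻²) + α² Var(1/ζ_1) - α² E(ζ_2⁻²) / m₀`. The first three terms are nonnegative
because `R_1 ≤ R_2`, and the last is at most `1/m₀` in absolute value. Since `α ≤ ζ_j ≤ K` for large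
`m`, the three terms are comparable to `E(1/R_1)`, `E((a/m)(R_2 - R_1))` and `Var(ζ_1)`. All
variables concerned are bounded, so the vanishing of these quantities is exactly the three
conditions in probability, and the vanishing of `Var(FDP)` is consistency (`variance_fdp_bounds`).

If `κ₀ = 1` and eventually `a ≤ A < 1 - α`, the identity with `g(r) = 1{r ≥ δm} / r` bounds `q_j =
P(R_j ≥ δm)` by `ρ q_{j+1} + (m₁ + j)/(δm)`, where `ρ = α/(1 - A) < 1` (`measureReal_le_rej`).
Iterating this bound forces `R_j / m → 0`, hence `ζ_1 → 1` in `L¹`. This yields the last two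
conditions and `E(FDP) → α`. -/

namespace StepUp

/-! ### Combinatorics of step-up tests under zeroing of `p`-values -/

variable {m : ℕ}

/-- The number of `p`-values that are at most `t`. -/
noncomputable def countLE (p : Fin m → ℝ) (t : ℝ) : ℕ :=
  (Finset.univ.filter fun k => p k ≤ t).card

/-- The vector of `p`-values in which those with index in `T` are replaced by `0`. -/
noncomputable def zeroOn (T : Finset (Fin m)) (p : Fin m → ℝ) : Fin m → ℝ :=
  fun i => if i ∈ T then 0 else p i

/-- Critical values `0 = c 0 ≤ c 1 ≤ … ≤ c m ≤ 1`. -/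
structure IsCritical (m : ℕ) (c : ℕ → ℝ) : Prop where
  zero : c 0 = 0
  mono : ∀ i j, i ≤ j → j ≤ m → c i ≤ c j
  le_one : c m ≤ 1

lemma IsCritical.nonneg {c : ℕ → ℝ} (hc : IsCritical m c) {i : ℕ} (hi : i ≤ m) : 0 ≤ c i := by
  rw [← hc.zero]; exact hc.mono 0 i (Nat.zero_le _) hi

lemma IsCritical.le_one_of_le {c : ℕ → ℝ} (hc : IsCritical m c) {i : ℕ} (hi : i ≤ m) :
    c i ≤ 1 :=
  (hc.mono i m hi le_rfl).trans hc.le_one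

lemma countLE_comp_perm (p : Fin m → ℝ) (σ : Equiv.Perm (Fin m)) (t : ℝ) :
    countLE (fun i => p (σ i)) t = countLE p t := by
  unfold countLE
  refine Finset.card_bij (fun k _ => σ k) ?_ ?_ ?_
  · intro k hk; simpa using hk
  · intro k _ l _ h; exact σ.injective h
  · intro k hk; exact ⟨σ.symm k, by simpa using hk, by simp⟩

/-- Order statistics and counts are inverse to each other. Working with counts removes the sorting
permutation from all later arguments. -/
lemma orderedPValue_le_iff (p : Fin m → ℝ) {i : ℕ} (hi : 0 < i) (him : i ≤ m) (t : ℝ) :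
    orderedPValue p i ≤ t ↔ i ≤ countLE p t := by
  have h1 := Tuple.lt_card_le_iff_apply_le_of_monotone (j := (⟨i - 1, by omega⟩ : Fin m))
    (a := t) (Tuple.monotone_sort p)
  rw [← countLE_comp_perm p (Tuple.sort p) t]
  unfold orderedPValue countLE
  rw [dif_pos ⟨hi, him⟩]
  simp only [Function.comp] at h1
  rw [← h1]
  simp only
  omega

lemma numRejections_eq_sup {c : ℕ → ℝ} (hc : c 0 = 0) (p : Fin m → ℝ) :
    numRejections c p =
      ((Finset.range (m + 1)).filter fun i => i ≤ countLE p (c i)).sup id := by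
  unfold numRejections
  congr 1
  refine Finset.filter_congr fun i hi => ?_
  rcases Nat.eq_zero_or_pos i with rfl | h
  · simp [orderedPValue, hc]
  · exact orderedPValue_le_iff p h (by simpa [Nat.lt_succ_iff] using hi) _

lemma le_numRejections {c : ℕ → ℝ} (hc : c 0 = 0) {p : Fin m → ℝ} {i : ℕ} (him : i ≤ m)
    (hi : i ≤ countLE p (c i)) : i ≤ numRejections c p := by
  rw [numRejections_eq_sup hc]
  exact Finset.le_sup (f := id) (by simp [hi]; omega)

lemma numRejections_mem {c : ℕ → ℝ} (hc : c 0 = 0) (p : Fin m → ℝ) :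
    numRejections c p ≤ m ∧ numRejections c p ≤ countLE p (c (numRejections c p)) := by
  have hne : ((Finset.range (m + 1)).filter fun i => i ≤ countLE p (c i)).Nonempty :=
    ⟨0, by simp⟩
  obtain ⟨r, hr, h⟩ := Finset.exists_mem_eq_sup _ hne id
  rw [← numRejections_eq_sup hc] at h
  rw [h]
  simp only [Finset.mem_filter, Finset.mem_range] at hr
  exact ⟨by simp; omega, hr.2⟩

lemma numRejections_le {c : ℕ → ℝ} (hc : c 0 = 0) (p : Fin m → ℝ) : numRejections c p ≤ m :=
  (numRejections_mem hc p).1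

lemma numRejections_comp_perm {c : ℕ → ℝ} (hc : c 0 = 0) (p : Fin m → ℝ)
    (σ : Equiv.Perm (Fin m)) :
    numRejections c (fun i => p (σ i)) = numRejections c p := by
  simp only [numRejections_eq_sup hc, countLE_comp_perm]

lemma countLE_le_of_le {p q : Fin m → ℝ} (h : ∀ i, q i ≤ p i) (t : ℝ) :
    countLE p t ≤ countLE q t :=
  Finset.card_le_card fun k hk => by
    simp only [Finset.mem_filter, Finset.mem_univ, true_and] at hk ⊢
    exact (h k).trans hk

lemma numRejections_le_of_le {c : ℕ → ℝ} (hc : c 0 = 0) {p q : Fin m → ℝ}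
    (h : ∀ i, q i ≤ p i) : numRejections c p ≤ numRejections c q :=
  le_numRejections hc (numRejections_le hc p)
    ((numRejections_mem hc p).2.trans (countLE_le_of_le h _))

lemma zeroOn_le {p : Fin m → ℝ} (hp : ∀ i, 0 ≤ p i) {S T : Finset (Fin m)} (h : S ⊆ T)
    (i : Fin m) : zeroOn T p i ≤ zeroOn S p i := by
  unfold zeroOn
  split_ifs with h1 h2 h2
  · exact le_rfl
  · exact hp i
  · exact absurd (h h2) h1
  · exact le_rfl

lemma numRejections_zeroOn_mono {c : ℕ → ℝ} (hc : c 0 = 0) {p : Fin m → ℝ}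
    (hp : ∀ i, 0 ≤ p i) {S T : Finset (Fin m)} (h : S ⊆ T) :
    numRejections c (zeroOn S p) ≤ numRejections c (zeroOn T p) :=
  numRejections_le_of_le hc (zeroOn_le hp h)

/-- Setting a rejected `p`-value to `0` does not change the number of rejections. -/
lemma numRejections_insert_eq {c : ℕ → ℝ} (hc : IsCritical m c) {p : Fin m → ℝ}
    (hp : ∀ i, 0 ≤ p i) {T : Finset (Fin m)} {i : Fin m}
    (h : p i ≤ c (numRejections c (zeroOn (insert i T) p))) :
    numRejections c (zeroOn (insert i T) p) = numRejections c (zeroOn T p) := by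
  refine le_antisymm ?_ (numRejections_zeroOn_mono hc.zero hp (Finset.subset_insert i T))
  obtain ⟨h1, h2⟩ := numRejections_mem hc.zero (zeroOn (insert i T) p)
  -- The larger index `R` remains feasible without zeroing `p i`: since `p i ≤ c R` already, `i` is
  -- counted at level `c R` either way.
  refine le_numRejections hc.zero h1 (h2.trans (Finset.card_le_card fun k hk => ?_))
  simp only [Finset.mem_filter, Finset.mem_univ, true_and] at hk ⊢
  by_cases hki : k = i
  · subst hki
    unfold zeroOn
    split_ifs
    · exact hc.nonneg h1
    · exact h
  · simpa [zeroOn, hki] using hk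

/-- The threshold on the right does not depend on `p i`, which is what makes independence
applicable. Zeroing only raises the threshold; conversely, a value below the raised threshold leaves
the number of rejections unchanged when zeroed. -/
lemma le_crit_iff_insert {c : ℕ → ℝ} (hc : IsCritical m c) {p : Fin m → ℝ}
    (hp : ∀ i, 0 ≤ p i) {T : Finset (Fin m)} {i : Fin m} :
    p i ≤ c (numRejections c (zeroOn T p)) ↔
      p i ≤ c (numRejections c (zeroOn (insert i T) p)) := by
  refine ⟨fun h => h.trans (hc.mono _ _ (numRejections_zeroOn_mono hc.zero hp
    (Finset.subset_insert i T)) (numRejections_le hc.zero _)), fun h => ?_⟩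
  rwa [← numRejections_insert_eq hc hp h]

/-- At least one rejection takes place if some `p`-value has been replaced by `0`. -/
lemma numRejections_zeroOn_pos {c : ℕ → ℝ} (hc : IsCritical m c) (p : Fin m → ℝ)
    {T : Finset (Fin m)} (hT : T.Nonempty) : 1 ≤ numRejections c (zeroOn T p) := by
  obtain ⟨i, hi⟩ := hT
  have hm : 1 ≤ m := Nat.one_le_iff_ne_zero.2 (by rintro rfl; exact i.elim0)
  refine le_numRejections hc.zero hm (Finset.card_pos.2 ⟨i, ?_⟩)
  rw [Finset.mem_filter]
  simp [zeroOn, hi, hc.nonneg hm]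

/-- The `j` smallest elements of `I₀`. -/
noncomputable def firstNulls (I₀ : Finset (Fin m)) (j : ℕ) : Finset (Fin m) :=
  I₀.filter fun i => (I₀.filter fun k => k < i).card < j

lemma substPValues_eq_zeroOn (I₀ : Finset (Fin m)) (j : ℕ) (p : Fin m → ℝ) :
    substPValues I₀ j p = zeroOn (firstNulls I₀ j) p := by
  ext i
  simp [substPValues, zeroOn, firstNulls]

lemma firstNulls_subset (I₀ : Finset (Fin m)) (j : ℕ) : firstNulls I₀ j ⊆ I₀ :=
  Finset.filter_subset _ _

lemma zeroOn_empty (p : Fin m → ℝ) : zeroOn ∅ p = p := by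
  ext; simp [zeroOn]

lemma firstNulls_zero (I₀ : Finset (Fin m)) : firstNulls I₀ 0 = ∅ := by
  simp [firstNulls]

/-- The next smallest index is adjoined in passing from `j` to `j + 1`. -/
lemma firstNulls_succ (I₀ : Finset (Fin m)) {j : ℕ} (hj : j < I₀.card) :
    (firstNulls I₀ j).card = j ∧
      ∃ x ∈ I₀ \ firstNulls I₀ j, firstNulls I₀ (j + 1) = insert x (firstNulls I₀ j) := by
  -- In the increasing enumeration of `I₀`, the `l`-th element has exactly `l` predecessors. Thus
  -- `firstNulls` is the image of an initial segment.
  have rank : ∀ l : Fin I₀.card, (I₀.filter fun k => k < I₀.orderEmbOfFin rfl l).card = l := by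
    intro l
    have : (I₀.filter fun k => k < I₀.orderEmbOfFin rfl l) =
        (Finset.univ.filter fun k : Fin I₀.card => k < l).map (I₀.orderEmbOfFin rfl).toEmbedding := by
      ext k
      simp only [Finset.mem_filter, Finset.mem_map, Finset.mem_univ, true_and]
      constructor
      · rintro ⟨hk, hlt⟩
        have : k ∈ Set.range (I₀.orderEmbOfFin rfl) := by
          rw [Finset.range_orderEmbOfFin]; exact hk
        obtain ⟨n, rfl⟩ := this
        exact ⟨n, by simpa using hlt, rfl⟩
      · rintro ⟨n, hn, rfl⟩
        exact ⟨I₀.orderEmbOfFin_mem rfl n, by simpa using hn⟩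
    have h2 : (Finset.univ.filter fun k : Fin I₀.card => k < l) = Finset.Iio l := by
      ext; simp
    rw [this, Finset.card_map, h2, Fin.card_Iio]
  have key : ∀ n, firstNulls I₀ n =
      (Finset.univ.filter fun k : Fin I₀.card => (k : ℕ) < n).map (I₀.orderEmbOfFin rfl).toEmbedding := by
    intro n
    ext k
    simp only [firstNulls, Finset.mem_filter, Finset.mem_map, Finset.mem_univ, true_and]
    constructor
    · rintro ⟨hk, hlt⟩
      have : k ∈ Set.range (I₀.orderEmbOfFin rfl) := by
        rw [Finset.range_orderEmbOfFin]; exact hk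
      obtain ⟨l, rfl⟩ := this
      rw [rank] at hlt
      exact ⟨l, hlt, rfl⟩
    · rintro ⟨l, hl, rfl⟩
      refine ⟨I₀.orderEmbOfFin_mem rfl l, ?_⟩
      have := rank l
      exact this.trans_lt hl
  refine ⟨?_, I₀.orderEmbOfFin rfl ⟨j, hj⟩, ?_, ?_⟩
  · rw [key, Finset.card_map]
    have : (Finset.univ.filter fun k : Fin I₀.card => (k : ℕ) < j) = Finset.Iio ⟨j, hj⟩ := by
      ext; simp [Fin.lt_def]
    rw [this, Fin.card_Iio]
  · rw [Finset.mem_sdiff]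
    refine ⟨I₀.orderEmbOfFin_mem rfl _, ?_⟩
    simp [firstNulls, rank]
  · rw [key, key, ← RelEmbedding.coe_toEmbedding, ← Finset.map_insert]
    congr 1
    ext k
    simp only [Finset.mem_filter, Finset.mem_univ, true_and, Finset.mem_insert, Fin.ext_iff]
    omega

/-- At least `R - #T - #I₀ᶜ` true null hypotheses outside `T` are rejected. -/
lemma numRejections_le_add {c : ℕ → ℝ} (hc : c 0 = 0) (p : Fin m → ℝ)
    (I₀ T : Finset (Fin m)) :
    numRejections c (zeroOn T p) ≤
      ((I₀ \ T).filter fun i => p i ≤ c (numRejections c (zeroOn T p))).card +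
        (I₀ᶜ.card + T.card) := by
  refine (numRejections_mem hc (zeroOn T p)).2.trans ?_
  unfold countLE
  refine le_trans (Finset.card_le_card ?_) ((Finset.card_union_le _ _).trans
    (Nat.add_le_add_left (Finset.card_union_le _ _) _))
  intro k hk
  simp only [Finset.mem_filter, Finset.mem_univ, true_and, Finset.mem_union, Finset.mem_sdiff,
    Finset.mem_compl] at hk ⊢
  by_cases h1 : k ∈ T
  · tauto
  · simp only [zeroOn, h1, if_false] at hk
    tauto

/-! ### Admissible critical values and measurability -/

lemma isCritical_critVal {α a b : ℝ} (hα0 : 0 < α) (hm : 0 < m)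
    (hab : AdmissibleParams α a b) : IsCritical m (critVal α a b m) := by
  have ha0 : 0 ≤ a := by rcases hab with h | h; exacts [h.2.1, h.2.1]
  have ha1 : a ≤ 1 - α := by rcases hab with h | h; exacts [h.2.2, h.2.2.le]
  have hb0 : 0 ≤ b := by rcases hab with h | h; exacts [h.1.le, h.1.ge]
  have hm' : (0 : ℝ) < m := by exact_mod_cast hm
  have hpos : ∀ i : ℕ, i ≤ m → 0 < (m : ℝ) + b - a * i := by
    intro i hi
    have hi' : (i : ℝ) ≤ m := by exact_mod_cast hi
    nlinarith [mul_le_mul_of_nonneg_left hi' ha0, mul_pos hα0 hm']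
  refine ⟨by simp [critVal], fun i j hij hj => ?_, ?_⟩
  · have hij' : (i : ℝ) ≤ j := by exact_mod_cast hij
    unfold critVal
    refine div_le_div₀ (by positivity) (by gcongr) (hpos j hj) ?_
    nlinarith
  · unfold critVal
    rw [div_le_one (hpos m le_rfl)]
    nlinarith

lemma measurable_countLE (t : ℝ) : Measurable fun p : Fin m → ℝ => countLE p t := by
  unfold countLE
  simp only [Finset.card_filter]
  exact Finset.measurable_sum _ fun k _ =>
    Measurable.ite (measurableSet_le (measurable_pi_apply k) measurable_const)
      measurable_const measurable_const

/-- The number of rejections factors through the finite vector of counts at the critical values,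
which lives in a discrete space. -/
lemma measurable_numRejections {c : ℕ → ℝ} (hc : c 0 = 0) :
    Measurable fun p : Fin m → ℝ => numRejections c p := by
  have h : (fun p : Fin m → ℝ => numRejections c p) =
      (fun g : Fin (m + 1) → ℕ => (Finset.univ.filter fun i : Fin (m + 1) => (i : ℕ) ≤ g i).sup
        fun i => (i : ℕ)) ∘ fun p i => countLE p (c i) := by
    funext p
    rw [numRejections_eq_sup hc]
    apply le_antisymm
    · refine Finset.sup_le fun i hi => ?_
      simp only [Finset.mem_filter, Finset.mem_range] at hi
      exact Finset.le_sup (f := fun i : Fin (m + 1) => (i : ℕ)) (b := ⟨i, hi.1⟩)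
        (by simpa using hi.2)
    · refine Finset.sup_le fun i hi => ?_
      simp only [Finset.mem_filter, Finset.mem_univ, true_and] at hi
      exact Finset.le_sup (f := id) (b := (i : ℕ)) (by simpa using ⟨Nat.lt_succ_iff.1 i.2, hi⟩)
  rw [h]
  exact (Measurable.of_discrete).comp (measurable_pi_lambda _ fun i => measurable_countLE _)

lemma measurable_zeroOn (T : Finset (Fin m)) : Measurable (zeroOn T) := by
  refine measurable_pi_lambda _ fun i => ?_
  unfold zeroOn
  split_ifs
  · exact measurable_const
  · exact measurable_pi_apply i

lemma zeroOn_zeroOn (S T : Finset (Fin m)) (p : Fin m → ℝ) :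
    zeroOn S (zeroOn T p) = zeroOn (S ∪ T) p := by
  ext i
  simp only [zeroOn, Finset.mem_union]
  split_ifs <;> tauto

/-! ### Integrating out an independent uniform variable -/

section Uniform

variable {Ω E : Type*} [MeasurableSpace Ω] [MeasurableSpace E] {P : Measure Ω}
  [IsProbabilityMeasure P]

/-- Integrating out a uniform variable `A` that is independent of `W`. -/
lemma integral_ite_le_of_indepFun {A : Ω → ℝ} {W : Ω → E} (hA : Measurable A)
    (hW : Measurable W) (hind : IndepFun A W P)
    (hunif : ∀ x ∈ Set.Icc (0 : ℝ) 1, P {ω | A ω ≤ x} = ENNReal.ofReal x)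
    {f g : E → ℝ} (hf : Measurable f) (hf01 : ∀ w, f w ∈ Set.Icc (0 : ℝ) 1)
    (hg : Measurable g) {C : ℝ} (hgC : ∀ w, |g w| ≤ C) :
    ∫ ω, (if A ω ≤ f (W ω) then g (W ω) else 0) ∂P = ∫ ω, f (W ω) * g (W ω) ∂P := by
  have : IsProbabilityMeasure (P.map A) := Measure.isProbabilityMeasure_map hA.aemeasurable
  have : IsProbabilityMeasure (P.map W) := Measure.isProbabilityMeasure_map hW.aemeasurable
  have hF : Measurable fun z : ℝ × E => if z.1 ≤ f z.2 then g z.2 else 0 :=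
    Measurable.ite (measurableSet_le measurable_fst (hf.comp measurable_snd))
      (hg.comp measurable_snd) measurable_const
  have hmap := (indepFun_iff_map_prod_eq_prod_map_map hA.aemeasurable hW.aemeasurable).1 hind
  calc ∫ ω, (if A ω ≤ f (W ω) then g (W ω) else 0) ∂P
      = ∫ z, (if z.1 ≤ f z.2 then g z.2 else 0) ∂(P.map fun ω => (A ω, W ω)) := by
        rw [integral_map (hA.prodMk hW).aemeasurable hF.aestronglyMeasurable]
    -- Fubini with the uniform variable innermost: for fixed `w` the inner integral is the uniform
    -- distribution function at `f w`, times `g w`.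
    _ = ∫ w, ∫ a, (if a ≤ f w then g w else 0) ∂(P.map A) ∂(P.map W) := by
        rw [hmap, integral_prod_symm]
        refine Integrable.of_bound hF.aestronglyMeasurable C (ae_of_all _ fun z => ?_)
        split_ifs
        · exact hgC _
        · simpa using (abs_nonneg _).trans (hgC z.2)
    _ = ∫ w, f w * g w ∂(P.map W) := by
        refine integral_congr_ae (ae_of_all _ fun w => ?_)
        have h1 : (fun a => if a ≤ f w then g w else 0) =
            (Set.Iic (f w)).indicator fun _ => g w := by
          ext a; simp [Set.indicator]
        simp only [h1]
        rw [integral_indicator measurableSet_Iic, setIntegral_const, smul_eq_mul,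
          measureReal_def, Measure.map_apply hA measurableSet_Iic]
        have h2 : P (A ⁻¹' Set.Iic (f w)) = ENNReal.ofReal (f w) := hunif _ (hf01 w)
        rw [h2, ENNReal.toReal_ofReal (hf01 w).1]
    _ = ∫ ω, f (W ω) * g (W ω) ∂P := by
        exact integral_map hW.aemeasurable (hf.mul hg).aestronglyMeasurable

/-- The joint law is a threefold product measure, which may be rebracketed. This isolates one true
`p`-value from the other true ones and the false ones jointly. -/
lemma indepFun_prod_of_indepFun {E₁ E₂ E₃ : Type*} [MeasurableSpace E₁] [MeasurableSpace E₂]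
    [MeasurableSpace E₃] {A : Ω → E₁} {B : Ω → E₂} {Y : Ω → E₃} (hA : Measurable A)
    (hB : Measurable B) (hY : Measurable Y) (hAB : IndepFun A B P)
    (hABY : IndepFun (fun ω => (A ω, B ω)) Y P) : IndepFun A (fun ω => (B ω, Y ω)) P := by
  have : IsProbabilityMeasure (P.map A) := Measure.isProbabilityMeasure_map hA.aemeasurable
  have : IsProbabilityMeasure (P.map B) := Measure.isProbabilityMeasure_map hB.aemeasurable
  have : IsProbabilityMeasure (P.map Y) := Measure.isProbabilityMeasure_map hY.aemeasurable
  have hBY : IndepFun B Y P := hABY.comp measurable_snd measurable_id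
  rw [indepFun_iff_map_prod_eq_prod_map_map hA.aemeasurable (hB.prodMk hY).aemeasurable]
  have h1 := (indepFun_iff_map_prod_eq_prod_map_map hA.aemeasurable hB.aemeasurable).1 hAB
  have h2 := (indepFun_iff_map_prod_eq_prod_map_map hB.aemeasurable hY.aemeasurable).1 hBY
  have h3 := (indepFun_iff_map_prod_eq_prod_map_map (hA.prodMk hB).aemeasurable
    hY.aemeasurable).1 hABY
  rw [h2]
  have h4 : P.map (fun ω => (A ω, (B ω, Y ω))) =
      (P.map (fun ω => ((A ω, B ω), Y ω))).map MeasurableEquiv.prodAssoc := by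
    rw [Measure.map_map MeasurableEquiv.prodAssoc.measurable ((hA.prodMk hB).prodMk hY)]
    rfl
  rw [h4, h3, h1]
  exact Measure.prodAssoc_prod

end Uniform

/-! ### Leave-one-out and leave-two-out identities, exchangeability -/

section Model

variable {Ω : Type*} {p : Fin m → Ω → ℝ} {c : ℕ → ℝ}

/-- The number of rejections when the `p`-values with index in `T` are replaced by `0`. -/
noncomputable def rej (c : ℕ → ℝ) (p : Fin m → Ω → ℝ) (T : Finset (Fin m)) (ω : Ω) : ℕ :=
  numRejections c (zeroOn T fun i => p i ω)

lemma rej_le (hc : c 0 = 0) (T : Finset (Fin m)) (ω : Ω) : rej c p T ω ≤ m :=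
  numRejections_le hc _

/-- The true null hypotheses outside `T` that are rejected after substitution on `T`. -/
noncomputable def falseRej (c : ℕ → ℝ) (p : Fin m → Ω → ℝ) (I₀ T : Finset (Fin m)) (ω : Ω) : ℕ :=
  ((I₀ \ T).filter fun i => p i ω ≤ c (rej c p T ω)).card

lemma falseRej_mul (I₀ T : Finset (Fin m)) (ω : Ω) (x : ℝ) :
    (falseRej c p I₀ T ω : ℝ) * x =
      ∑ i ∈ I₀ \ T, if p i ω ≤ c (rej c p T ω) then x else 0 := by
  rw [← Finset.sum_filter, Finset.sum_const, nsmul_eq_mul]; rfl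

end Model

section Independence

variable {Ω : Type*} [MeasurableSpace Ω] {P : Measure Ω} [IsProbabilityMeasure P]
  {p : Fin m → Ω → ℝ} {I₀ : Finset (Fin m)} {c : ℕ → ℝ}

lemma measurable_rej (hc : c 0 = 0) (hp : ∀ i, Measurable (p i)) (T : Finset (Fin m)) :
    Measurable (rej c p T) :=
  (measurable_numRejections hc).comp ((measurable_zeroOn T).comp (measurable_pi_lambda _ hp))

/-- A true `p`-value is independent of the vector of all other `p`-values. -/
lemma BasicIndependence.indepFun_zeroOn (h : BasicIndependence P p I₀) {i : Fin m}
    (hi : i ∈ I₀) : IndepFun (p i) (fun ω => zeroOn {i} fun k => p k ω) P := by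
  classical
  have hAB : IndepFun (p i)
      (fun ω (k : (Finset.univ.erase (⟨i, hi⟩ : {i // i ∈ I₀}) : Finset _)) => p k.1 ω) P := by
    have := h.indep_true.indepFun_finset {⟨i, hi⟩} (Finset.univ.erase ⟨i, hi⟩) (by simp)
      fun k => h.measurable k
    have hφ : Measurable fun x : (({⟨i, hi⟩} : Finset {i // i ∈ I₀}) → ℝ) =>
        x ⟨⟨i, hi⟩, by simp⟩ := measurable_pi_apply _
    exact this.comp hφ measurable_id
  have hABY : IndepFun (fun ω => (p i ω,
      fun (k : (Finset.univ.erase (⟨i, hi⟩ : {i // i ∈ I₀}) : Finset _)) => p k.1 ω))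
      (fun ω (k : {k : Fin m // k ∉ I₀}) => p k ω) P :=
    h.indep_true_false.comp
      (φ := fun x => (x ⟨i, hi⟩,
        fun k : (Finset.univ.erase (⟨i, hi⟩ : {i // i ∈ I₀}) : Finset _) => x k.1))
      ((measurable_pi_apply _).prodMk (measurable_pi_lambda _ fun k => measurable_pi_apply _))
      measurable_id
  have key := indepFun_prod_of_indepFun (h.measurable i)
    (measurable_pi_lambda _ fun k => h.measurable _)
    (measurable_pi_lambda _ fun k => h.measurable _) hAB hABY
  -- Reassembles the vector zeroed at `i` from the blocks shown to be independent of `p i`.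
  let ψ : ((k : (Finset.univ.erase (⟨i, hi⟩ : {i // i ∈ I₀}) : Finset _)) → ℝ) ×
      ({k : Fin m // k ∉ I₀} → ℝ) → Fin m → ℝ := fun z k =>
    if hk : k ∈ I₀ then (if hki : k = i then 0 else
      z.1 ⟨⟨k, hk⟩, by simp [hki]⟩) else z.2 ⟨k, hk⟩
  have hψ : Measurable ψ := by
    refine measurable_pi_lambda _ fun k => ?_
    simp only [ψ]
    split_ifs
    · exact measurable_const
    · exact (measurable_pi_apply _).comp measurable_fst
    · exact (measurable_pi_apply _).comp measurable_snd
  have hW : (fun ω => zeroOn {i} fun k => p k ω) = ψ ∘ fun ω => (fun k => p k.1 ω, fun k => p k ω) := by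
    funext ω k
    simp only [zeroOn, Function.comp, ψ, Finset.mem_singleton]
    by_cases hk : k ∈ I₀
    · by_cases hki : k = i
      · subst hki; simp [hk]
      · simp [hk, hki]
    · have : k ≠ i := fun h => hk (h ▸ hi)
      simp [hk, this]
  rw [hW]
  exact key.comp measurable_id hψ

/-- Leave-one-out identity with one more true null hypothesis. -/
lemma BasicIndependence.integral_ite_le_rej (h : BasicIndependence P p I₀)
    (hc : IsCritical m c) {i : Fin m} (hi : i ∈ I₀) (T : Finset (Fin m)) (g : ℕ → ℝ) :
    ∫ ω, (if p i ω ≤ c (rej c p T ω) then g (rej c p T ω) else 0) ∂P =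
      ∫ ω, c (rej c p (insert i T) ω) * g (rej c p (insert i T) ω) ∂P := by
  have hN : Measurable fun w : Fin m → ℝ => numRejections c (zeroOn T w) :=
    (measurable_numRejections hc.zero).comp (measurable_zeroOn T)
  have h1 := integral_ite_le_of_indepFun (h.measurable i)
    ((measurable_zeroOn {i}).comp (measurable_pi_lambda _ h.measurable))
    (h.indepFun_zeroOn hi) (h.uniform_true i hi)
    (f := fun w => c (numRejections c (zeroOn T w)))
    (g := fun w => g (numRejections c (zeroOn T w)))
    (Measurable.of_discrete.comp hN)
    (fun w => ⟨hc.nonneg (numRejections_le hc.zero _), hc.le_one_of_le (numRejections_le hc.zero _)⟩)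
    -- A crude bound suffices, as the number of rejections takes only the values `0, …, m`.
    (Measurable.of_discrete.comp hN) (C := ∑ r ∈ Finset.range (m + 1), |g r|)
    (fun w => Finset.single_le_sum (f := fun r => |g r|) (fun _ _ => abs_nonneg _)
      (Finset.mem_range.2 (Nat.lt_succ_of_le (numRejections_le hc.zero _))))
  have h2 : ∀ ω, numRejections c (zeroOn T (zeroOn {i} fun k => p k ω)) =
      rej c p (insert i T) ω := by
    intro ω
    rw [zeroOn_zeroOn, Finset.union_comm, ← Finset.insert_eq]; rfl
  simp only [Function.comp_def, h2] at h1
  rw [← h1]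
  -- The events with old and new threshold coincide, and on them zeroing `p i` leaves the number of
  -- rejections unchanged, so `g` has the same argument.
  refine integral_congr_ae (ae_of_all _ fun ω => ?_)
  have hp : ∀ i, 0 ≤ p i ω := fun i => (h.mem_Icc i ω).1
  simp only
  by_cases h3 : p i ω ≤ c (rej c p (insert i T) ω)
  · have h4 : p i ω ≤ c (rej c p T ω) := (le_crit_iff_insert hc hp).2 h3
    have h5 : rej c p (insert i T) ω = rej c p T ω := numRejections_insert_eq hc hp h3
    rw [if_pos h3, if_pos h4, h5]
  · have h4 : ¬ p i ω ≤ c (rej c p T ω) := fun h' => h3 ((le_crit_iff_insert hc hp).1 h')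
    rw [if_neg h3, if_neg h4]

/-- Leave-two-out identity. -/
lemma BasicIndependence.integral_ite_le_and_le_rej (h : BasicIndependence P p I₀)
    (hc : IsCritical m c) {i k : Fin m} (hi : i ∈ I₀) (hk : k ∈ I₀) (hik : k ≠ i) (g : ℕ → ℝ) :
    ∫ ω, (if p i ω ≤ c (rej c p ∅ ω) ∧ p k ω ≤ c (rej c p ∅ ω) then g (rej c p ∅ ω) else 0) ∂P =
      ∫ ω, c (rej c p {k, i} ω) ^ 2 * g (rej c p {k, i} ω) ∂P := by
  have hN : Measurable fun w : Fin m → ℝ => numRejections c w := measurable_numRejections hc.zero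
  have h1 := integral_ite_le_of_indepFun (h.measurable i)
    ((measurable_zeroOn {i}).comp (measurable_pi_lambda _ h.measurable))
    (h.indepFun_zeroOn hi) (h.uniform_true i hi)
    (f := fun w => c (numRejections c w))
    (g := fun w => if w k ≤ c (numRejections c w) then g (numRejections c w) else 0)
    (Measurable.of_discrete.comp hN)
    (fun w => ⟨hc.nonneg (numRejections_le hc.zero _), hc.le_one_of_le (numRejections_le hc.zero _)⟩)
    (Measurable.ite (measurableSet_le (measurable_pi_apply k) (Measurable.of_discrete.comp hN))
      (Measurable.of_discrete.comp hN) measurable_const)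
    (C := ∑ r ∈ Finset.range (m + 1), |g r|)
    (fun w => by
      have : |g (numRejections c w)| ≤ ∑ r ∈ Finset.range (m + 1), |g r| :=
        Finset.single_le_sum (f := fun r => |g r|) (fun _ _ => abs_nonneg _)
          (Finset.mem_range.2 (Nat.lt_succ_of_le (numRejections_le hc.zero _)))
      split_ifs
      · exact this
      · simpa using (abs_nonneg _).trans this)
  have h2 : ∀ ω, numRejections c (zeroOn {i} fun k => p k ω) = rej c p {i} ω := fun ω => rfl
  have h2' : ∀ ω, (zeroOn {i} fun k => p k ω) k = p k ω := fun ω => by simp [zeroOn, hik]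
  simp only [Function.comp_def, h2, h2'] at h1
  -- Integrating out `p i` has produced one factor `c`; a second application to `p k`, with that
  -- factor absorbed into `g`, produces the square.
  have h6 := h.integral_ite_le_rej hc hk {i} (fun r => c r * g r)
  calc _ = ∫ ω, (if p i ω ≤ c (rej c p {i} ω) then
        (if p k ω ≤ c (rej c p {i} ω) then g (rej c p {i} ω) else 0) else 0) ∂P := by
        refine integral_congr_ae (ae_of_all _ fun ω => ?_)
        have hp : ∀ i, 0 ≤ p i ω := fun i => (h.mem_Icc i ω).1
        simp only
        have e : ({i} : Finset (Fin m)) = insert i ∅ := by simp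
        by_cases h3 : p i ω ≤ c (rej c p {i} ω)
        · have h4 : p i ω ≤ c (rej c p ∅ ω) := (le_crit_iff_insert hc hp).2 (by rw [← e]; exact h3)
          have h5 : rej c p {i} ω = rej c p ∅ ω := by
            rw [e]; exact numRejections_insert_eq hc hp (by rw [← e]; exact h3)
          rw [if_pos h3, h5]
          simp [h4]
        · have h4 : ¬ p i ω ≤ c (rej c p ∅ ω) := fun h' =>
            h3 (by rw [e]; exact (le_crit_iff_insert hc hp).1 h')
          rw [if_neg h3, if_neg (fun h' => h4 h'.1)]
    _ = _ := h1
    _ = ∫ ω, (if p k ω ≤ c (rej c p {i} ω) then c (rej c p {i} ω) * g (rej c p {i} ω)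
          else 0) ∂P := by
        refine integral_congr_ae (ae_of_all _ fun ω => ?_)
        simp only
        split_ifs <;> simp
    _ = _ := h6
    _ = _ := by
        refine integral_congr_ae (ae_of_all _ fun ω => ?_)
        simp only
        ring

lemma BasicIndependence.identDistrib_true (h : BasicIndependence P p I₀) {i k : Fin m}
    (hi : i ∈ I₀) (hk : k ∈ I₀) : IdentDistrib (p i) (p k) P P := by
  refine ⟨(h.measurable i).aemeasurable, (h.measurable k).aemeasurable, ?_⟩
  have : IsProbabilityMeasure (P.map (p i)) :=
    Measure.isProbabilityMeasure_map (h.measurable i).aemeasurable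
  refine Measure.ext_of_Iic _ _ fun x => ?_
  rw [Measure.map_apply (h.measurable i) measurableSet_Iic,
    Measure.map_apply (h.measurable k) measurableSet_Iic]
  change P {ω | p i ω ≤ x} = P {ω | p k ω ≤ x}
  rcases lt_or_ge x 0 with hx | hx
  · have : ∀ l, {ω | p l ω ≤ x} = ∅ := fun l => by
      ext ω; simpa using hx.trans_le (h.mem_Icc l ω).1
    rw [this, this]
  · rcases le_or_gt x 1 with hx1 | hx1
    · rw [h.uniform_true i hi x ⟨hx, hx1⟩, h.uniform_true k hk x ⟨hx, hx1⟩]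
    · have : ∀ l, {ω | p l ω ≤ x} = Set.univ := fun l => by
        ext ω; simpa using (h.mem_Icc l ω).2.trans hx1.le
      rw [this, this]

/-- The law of the `p`-values is invariant under exchanging true null hypotheses. -/
lemma BasicIndependence.identDistrib_swap (h : BasicIndependence P p I₀) {i k : Fin m}
    (hi : i ∈ I₀) (hk : k ∈ I₀) :
    IdentDistrib (fun ω l => p (Equiv.swap i k l) ω) (fun ω l => p l ω) P P := by
  classical
  have hσ : ∀ l, l ∈ I₀ ↔ Equiv.swap i k l ∈ I₀ := by
    intro l
    by_cases h1 : l = i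
    · subst h1; simp [hi, hk]
    · by_cases h2 : l = k
      · subst h2; simp [hi, hk]
      · rw [Equiv.swap_apply_of_ne_of_ne h1 h2]
  let τ : {l // l ∈ I₀} → {l // l ∈ I₀} := fun l => ⟨Equiv.swap i k l, (hσ l).1 l.2⟩
  have hτ : Function.Injective τ := fun l l' hl =>
    Subtype.ext ((Equiv.swap i k).injective (congrArg Subtype.val hl))
  have hX : IdentDistrib (fun ω (l : {l // l ∈ I₀}) => p (τ l) ω)
      (fun ω (l : {l // l ∈ I₀}) => p l ω) P P :=
    IdentDistrib.pi (fun l => h.identDistrib_true (τ l).2 l.2)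
      (h.indep_true.precomp hτ) h.indep_true
  have hY : IdentDistrib (fun ω (l : {l // l ∉ I₀}) => p l ω)
      (fun ω (l : {l // l ∉ I₀}) => p l ω) P P :=
    IdentDistrib.refl (measurable_pi_lambda _ fun _ => h.measurable _).aemeasurable
  have hXY : IndepFun (fun ω (l : {l // l ∈ I₀}) => p (τ l) ω)
      (fun ω (l : {l // l ∉ I₀}) => p l ω) P :=
    h.indep_true_false.comp (φ := fun x l => x (τ l))
      (measurable_pi_lambda _ fun l => measurable_pi_apply _) measurable_id
  have key := hX.prodMk hY hXY h.indep_true_false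
  let ψ : ({l // l ∈ I₀} → ℝ) × ({l // l ∉ I₀} → ℝ) → Fin m → ℝ := fun z l =>
    if hl : l ∈ I₀ then z.1 ⟨l, hl⟩ else z.2 ⟨l, hl⟩
  have hψ : Measurable ψ := by
    refine measurable_pi_lambda _ fun l => ?_
    simp only [ψ]
    split_ifs
    · exact (measurable_pi_apply _).comp measurable_fst
    · exact (measurable_pi_apply _).comp measurable_snd
  have := key.comp hψ
  convert this using 1
  · funext ω l
    by_cases hl : l ∈ I₀
    · simp [ψ, hl, τ]
    · have h1 : l ≠ i := fun h => hl (h ▸ hi)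
      have h2 : l ≠ k := fun h => hl (h ▸ hk)
      simp [ψ, hl, Equiv.swap_apply_of_ne_of_ne h1 h2]
  · funext ω l
    by_cases hl : l ∈ I₀ <;> simp [ψ, hl]

/-- The law of the number of rejections does not depend on which true `p`-value is replaced. -/
lemma BasicIndependence.integral_rej_insert (h : BasicIndependence P p I₀) (hc : c 0 = 0)
    {i k : Fin m} (hi : i ∈ I₀) (hk : k ∈ I₀) {T : Finset (Fin m)} (hiT : i ∉ T) (hkT : k ∉ T)
    (g : ℕ → ℝ) :
    ∫ ω, g (rej c p (insert i T) ω) ∂P = ∫ ω, g (rej c p (insert k T) ω) ∂P := by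
  have hm : Measurable fun w : Fin m → ℝ => g (numRejections c (zeroOn (insert i T) w)) :=
    Measurable.of_discrete.comp ((measurable_numRejections hc).comp (measurable_zeroOn _))
  have h1 := ((h.identDistrib_swap hi hk).comp hm).integral_eq
  simp only [Function.comp_def] at h1
  refine h1.symm.trans (integral_congr_ae (ae_of_all _ fun ω => ?_))
  -- Zeroing at `i` after the swap equals zeroing at `k` before it, up to a permutation of
  -- coordinates, to which the number of rejections is blind.
  have h2 : zeroOn (insert i T) (fun l => p (Equiv.swap i k l) ω) =
      fun l => zeroOn (insert k T) (fun l => p l ω) (Equiv.swap i k l) := by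
    funext l
    have : l ∈ insert i T ↔ Equiv.swap i k l ∈ insert k T := by
      by_cases hli : l = i
      · subst hli; simp
      · by_cases hlk : l = k
        · subst hlk
          simp [hli, hiT, hkT, Ne.symm hli]
        · rw [Equiv.swap_apply_of_ne_of_ne hli hlk]
          simp [hli, hlk]
    simp [zeroOn, this]
  simp only [h2, numRejections_comp_perm hc]
  rfl

lemma integrable_rej (hc : c 0 = 0) (hp : ∀ i, Measurable (p i)) (T : Finset (Fin m))
    (g : ℕ → ℝ) : Integrable (fun ω => g (rej c p T ω)) P :=
  Integrable.of_bound (Measurable.of_discrete.comp (measurable_rej hc hp T)).aestronglyMeasurable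
    (∑ r ∈ Finset.range (m + 1), |g r|) (ae_of_all _ fun ω =>
    Finset.single_le_sum (f := fun r => |g r|) (fun _ _ => abs_nonneg _)
      (Finset.mem_range.2 (Nat.lt_succ_of_le (rej_le hc T ω))))

lemma integrable_ite_rej (hc : c 0 = 0) (hp : ∀ i, Measurable (p i)) (T : Finset (Fin m))
    (g : ℕ → ℝ) {q : Ω → Prop} [DecidablePred q] (hq : MeasurableSet {ω | q ω}) :
    Integrable (fun ω => if q ω then g (rej c p T ω) else 0) P := by
  have := (integrable_rej (P := P) hc hp T g).indicator hq
  refine this.congr (ae_of_all _ fun ω => ?_)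
  simp [Set.indicator]

lemma measurableSet_le_rej (hc : c 0 = 0) (hp : ∀ i, Measurable (p i)) (T : Finset (Fin m))
    (i : Fin m) : MeasurableSet {ω | p i ω ≤ c (rej c p T ω)} :=
  measurableSet_le (hp i) (Measurable.of_discrete.comp (measurable_rej hc hp T))

/-- Each of the `m₀ - j` nulls outside `firstNulls I₀ j` contributes one leave-one-out term. By
exchangeability all terms equal the one for the next null in order. -/
lemma BasicIndependence.integral_falseRej_mul (h : BasicIndependence P p I₀)
    (hc : IsCritical m c) {j : ℕ} (hj : j < I₀.card) (g : ℕ → ℝ) :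
    ∫ ω, (falseRej c p I₀ (firstNulls I₀ j) ω : ℝ) * g (rej c p (firstNulls I₀ j) ω) ∂P =
      ((I₀.card : ℝ) - j) * ∫ ω, c (rej c p (firstNulls I₀ (j + 1)) ω) *
        g (rej c p (firstNulls I₀ (j + 1)) ω) ∂P := by
  obtain ⟨hcard, x, hx, hT⟩ := firstNulls_succ I₀ hj
  rw [Finset.mem_sdiff] at hx
  simp only [falseRej_mul]
  rw [integral_finsetSum _ fun i _ =>
    integrable_ite_rej hc.zero h.measurable _ g (measurableSet_le_rej hc.zero h.measurable _ i)]
  have h1 : ∀ i ∈ I₀ \ firstNulls I₀ j,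
      ∫ ω, (if p i ω ≤ c (rej c p (firstNulls I₀ j) ω) then g (rej c p (firstNulls I₀ j) ω)
        else 0) ∂P = ∫ ω, c (rej c p (firstNulls I₀ (j + 1)) ω) *
        g (rej c p (firstNulls I₀ (j + 1)) ω) ∂P := by
    intro i hi
    rw [Finset.mem_sdiff] at hi
    rw [h.integral_ite_le_rej hc hi.1, hT]
    exact h.integral_rej_insert hc.zero hi.1 hx.1 hi.2 hx.2 fun r => c r * g r
  rw [Finset.sum_congr rfl h1, Finset.sum_const, nsmul_eq_mul,
    Finset.card_sdiff_of_subset (firstNulls_subset _ _), hcard, Nat.cast_sub hj.le]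

/-- The square of a sum of indicators splits into its diagonal, giving the first term, and `m₀ (m₀ -
1)` ordered pairs, each handled by the leave-two-out identity. -/
lemma BasicIndependence.integral_falseRej_sq_mul (h : BasicIndependence P p I₀)
    (hc : IsCritical m c) (h2 : 2 ≤ I₀.card) (g : ℕ → ℝ) :
    ∫ ω, (falseRej c p I₀ ∅ ω : ℝ) ^ 2 * g (rej c p ∅ ω) ∂P =
      (I₀.card : ℝ) * (∫ ω, c (rej c p (firstNulls I₀ 1) ω) * g (rej c p (firstNulls I₀ 1) ω) ∂P)
      + (I₀.card : ℝ) * ((I₀.card : ℝ) - 1) *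
        ∫ ω, c (rej c p (firstNulls I₀ 2) ω) ^ 2 * g (rej c p (firstNulls I₀ 2) ω) ∂P := by
  obtain ⟨-, x, hx, hT1⟩ := firstNulls_succ I₀ (j := 0) (by omega)
  obtain ⟨-, y, hy, hT2⟩ := firstNulls_succ I₀ (j := 1) (by omega)
  rw [firstNulls_zero] at hx hT1
  simp only [zero_add, insert_empty_eq] at hT1
  rw [hT1] at hy hT2
  simp only [Finset.mem_sdiff, Finset.mem_singleton, Finset.notMem_empty, not_false_eq_true,
    and_true] at hx hy
  -- Any pair is moved to the first two nulls by exchanging one index at a time; `k = x` is separate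
  -- because `x` is then already present.
  have pair : ∀ i ∈ I₀, ∀ k ∈ I₀, k ≠ i → ∀ g : ℕ → ℝ,
      ∫ ω, g (rej c p {k, i} ω) ∂P = ∫ ω, g (rej c p {y, x} ω) ∂P := by
    have one : ∀ k ∈ I₀, k ≠ x → ∀ g : ℕ → ℝ,
        ∫ ω, g (rej c p {k, x} ω) ∂P = ∫ ω, g (rej c p {y, x} ω) ∂P := fun k hk hkx g =>
      h.integral_rej_insert hc.zero hk hy.1 (by simpa using hkx) (by simpa using hy.2) g
    intro i hi k hk hki g
    by_cases hkx : k = x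
    · subst hkx
      rw [Finset.pair_comm]
      exact one i hi (Ne.symm hki) g
    · rw [← one k hk hkx g, Finset.pair_comm k i, Finset.pair_comm k x]
      exact h.integral_rej_insert hc.zero hi hx (by simpa using Ne.symm hki)
        (by simpa using Ne.symm hkx) g
  have hpt : ∀ ω, (falseRej c p I₀ ∅ ω : ℝ) ^ 2 * g (rej c p ∅ ω) =
      falseRej c p I₀ ∅ ω * g (rej c p ∅ ω) + ∑ i ∈ I₀, ∑ k ∈ I₀.erase i,
        if p i ω ≤ c (rej c p ∅ ω) ∧ p k ω ≤ c (rej c p ∅ ω) then g (rej c p ∅ ω) else 0 := by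
    intro ω
    rw [pow_two, mul_assoc]
    conv_lhs => rw [falseRej_mul]
    conv_rhs => rw [falseRej_mul]
    simp only [Finset.sdiff_empty]
    rw [← Finset.sum_add_distrib]
    refine Finset.sum_congr rfl fun i hi => ?_
    by_cases hpi : p i ω ≤ c (rej c p ∅ ω)
    · simp only [hpi, if_true, true_and]
      rw [falseRej_mul, Finset.sdiff_empty, ← Finset.add_sum_erase _ _ hi, if_pos hpi]
    · simp [hpi]
  simp only [hpt]
  have hint : ∀ i k : Fin m, Integrable (fun ω =>
      if p i ω ≤ c (rej c p ∅ ω) ∧ p k ω ≤ c (rej c p ∅ ω) then g (rej c p ∅ ω) else 0) P :=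
    fun i k => integrable_ite_rej hc.zero h.measurable _ g
      ((measurableSet_le_rej hc.zero h.measurable _ i).inter
        (measurableSet_le_rej hc.zero h.measurable _ k))
  have hint1 : Integrable (fun ω => (falseRej c p I₀ ∅ ω : ℝ) * g (rej c p ∅ ω)) P := by
    simp only [falseRej_mul]
    exact integrable_finsetSum _ fun i _ =>
      integrable_ite_rej hc.zero h.measurable _ g (measurableSet_le_rej hc.zero h.measurable _ i)
  rw [integral_add hint1 (integrable_finsetSum _ fun i _ => integrable_finsetSum _ fun k _ =>
    hint i k)]
  have h1 := h.integral_falseRej_mul hc (j := 0) (by omega) g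
  simp only [firstNulls_zero, zero_add, Nat.cast_zero, sub_zero] at h1
  rw [h1, integral_finsetSum _ fun i _ => integrable_finsetSum _ fun k _ => hint i k]
  congr 1
  have h3 : ∀ i ∈ I₀, ∫ ω, (∑ k ∈ I₀.erase i,
      if p i ω ≤ c (rej c p ∅ ω) ∧ p k ω ≤ c (rej c p ∅ ω) then g (rej c p ∅ ω) else 0) ∂P =
      ((I₀.card : ℝ) - 1) *
        ∫ ω, c (rej c p (firstNulls I₀ 2) ω) ^ 2 * g (rej c p (firstNulls I₀ 2) ω) ∂P := by
    intro i hi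
    rw [integral_finsetSum _ fun k _ => hint i k]
    have h4 : ∀ k ∈ I₀.erase i, ∫ ω, (if p i ω ≤ c (rej c p ∅ ω) ∧ p k ω ≤ c (rej c p ∅ ω)
        then g (rej c p ∅ ω) else 0) ∂P =
        ∫ ω, c (rej c p (firstNulls I₀ 2) ω) ^ 2 * g (rej c p (firstNulls I₀ 2) ω) ∂P := by
      intro k hk
      rw [Finset.mem_erase] at hk
      rw [h.integral_ite_le_and_le_rej hc hi hk.2 hk.1, hT2]
      exact pair i hi k hk.2 hk.1 fun r => c r ^ 2 * g r
    rw [Finset.sum_congr rfl h4, Finset.sum_const, nsmul_eq_mul, Finset.card_erase_of_mem hi,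
      Nat.cast_sub (by omega), Nat.cast_one]
  rw [Finset.sum_congr rfl h3, Finset.sum_const, nsmul_eq_mul, mul_assoc]

end Independence

/-! ### Bounds for the normalized denominator -/

section Params

variable {α a b : ℝ}

lemma AdmissibleParams.nonneg (hab : AdmissibleParams α a b) : 0 ≤ a := by
  rcases hab with h | h
  exacts [h.2.1, h.2.1]

lemma AdmissibleParams.le_one_sub (hab : AdmissibleParams α a b) : a ≤ 1 - α := by
  rcases hab with h | h
  exacts [h.2.2, h.2.2.le]

lemma AdmissibleParams.nonneg_right (hab : AdmissibleParams α a b) : 0 ≤ b := by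
  rcases hab with h | h
  exacts [h.1.le, h.1.ge]

/-- The normalized denominator `(m + b - a r) / m₀` of the critical values. -/
noncomputable def normDenom (a b : ℝ) (m m₀ r : ℕ) : ℝ := ((m : ℝ) + b - a * r) / (m₀ : ℝ)

lemma le_denom (hab : AdmissibleParams α a b) {r : ℕ} (hr : r ≤ m) :
    α * m ≤ (m : ℝ) + b - a * r := by
  have hr' : (r : ℝ) ≤ m := by exact_mod_cast hr
  have h1 : a * r ≤ (1 - α) * m :=
    mul_le_mul hab.le_one_sub hr' (Nat.cast_nonneg _) (hab.nonneg.trans hab.le_one_sub)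
  nlinarith [hab.nonneg_right]

lemma le_normDenom (hab : AdmissibleParams α a b) (hα : 0 < α) {r m₀ : ℕ} (hr : r ≤ m)
    (hm₀ : 0 < m₀) (hm₀m : m₀ ≤ m) : α ≤ normDenom a b m m₀ r := by
  have h1 : (0 : ℝ) < m₀ := by exact_mod_cast hm₀
  have h2 : (m₀ : ℝ) ≤ m := by exact_mod_cast hm₀m
  unfold normDenom
  rw [le_div_iff₀ h1]
  nlinarith [le_denom hab hr]

lemma normDenom_le (hab : AdmissibleParams α a b) {r m₀ : ℕ} {K : ℝ}
    (hK : ((m : ℝ) + b) / m₀ ≤ K) : normDenom a b m m₀ r ≤ K := by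
  refine le_trans ?_ hK
  unfold normDenom
  gcongr
  nlinarith [mul_nonneg hab.nonneg (Nat.cast_nonneg (α := ℝ) r)]

/-- The numerator of the critical value is linear in `r`, so dividing by `r` leaves only the
denominator. This turns the factors `c(R) / R` from the leave-one-out identities into `1/ζ`. -/
lemma critVal_mul_inv (hab : AdmissibleParams α a b) (hα : 0 < α) {r m₀ : ℕ} (hr : r ≤ m)
    (hr1 : 1 ≤ r) (hm₀ : 0 < m₀) (hm₀m : m₀ ≤ m) :
    (m₀ : ℝ) * (critVal α a b m r * (r : ℝ)⁻¹) = α * (normDenom a b m m₀ r)⁻¹ := by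
  have h1 : (0 : ℝ) < m₀ := by exact_mod_cast hm₀
  have h2 : (0 : ℝ) < m := by exact_mod_cast hm₀.trans_le hm₀m
  have h3 : 0 < (m : ℝ) + b - a * r := (mul_pos hα h2).trans_le (le_denom hab hr)
  have h4 : (0 : ℝ) < r := by exact_mod_cast hr1
  unfold critVal normDenom
  field_simp

end Params

/-! ### Variance of a reciprocal -/

section Variance

variable {Ω : Type*} [MeasurableSpace Ω] {P : Measure Ω} [IsProbabilityMeasure P]

/-- The variance is at most the mean square deviation from `1 / E X`, and inversion is Lipschitz
with constant `l⁻²` on `[l, ∞)`. -/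
lemma variance_inv_le {X : Ω → ℝ} (hX : Measurable X) {l u : ℝ} (hl : 0 < l)
    (hlX : ∀ ω, l ≤ X ω) (hXu : ∀ ω, X ω ≤ u) :
    Var[fun ω => (X ω)⁻¹; P] ≤ (l ^ 4)⁻¹ * Var[X; P] := by
  have hXi : Integrable X P := Integrable.of_bound hX.aestronglyMeasurable u (ae_of_all _ fun ω => by
    rw [Real.norm_eq_abs, abs_of_pos (hl.trans_le (hlX ω))]; exact hXu ω)
  have hXb : ∀ ω, ‖X ω - ∫ ω', X ω' ∂P‖ ≤ u + |∫ ω', X ω' ∂P| := fun ω => by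
    refine (norm_sub_le _ _).trans (add_le_add ?_ le_rfl)
    rw [Real.norm_eq_abs, abs_of_pos (hl.trans_le (hlX ω))]; exact hXu ω
  set e := ∫ ω', X ω' ∂P with he
  have hle : l ≤ e := by
    have := integral_mono (integrable_const l) hXi hlX
    simpa using this
  have he0 : 0 < e := hl.trans_le hle
  have hsub : Var[fun ω => (X ω)⁻¹; P] = Var[fun ω => (X ω)⁻¹ - e⁻¹; P] :=
    (variance_sub_const hX.inv.aestronglyMeasurable _).symm
  rw [hsub, variance_eq_integral hX.aemeasurable, ← integral_const_mul]
  refine (variance_le_expectation_sq (hX.inv.sub_const _).aestronglyMeasurable).trans ?_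
  have hbd : Integrable (fun ω => (l ^ 4)⁻¹ * (X ω - e) ^ 2) P := by
    refine (Integrable.of_bound ((hX.sub_const e).pow_const 2).aestronglyMeasurable
      ((u + |e|) ^ 2) (ae_of_all _ fun ω => ?_)).const_mul _
    rw [norm_pow]
    exact pow_le_pow_left₀ (norm_nonneg _) (hXb ω) 2
  refine integral_mono_of_nonneg (ae_of_all _ fun ω => by simp; positivity) hbd
    (ae_of_all _ fun ω => ?_)
  have hx : 0 < X ω := hl.trans_le (hlX ω)
  have h1 : (X ω)⁻¹ - e⁻¹ = (e - X ω) * (X ω * e)⁻¹ := by field_simp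
  have h2 : l ^ 2 ≤ X ω * e := by rw [pow_two]; exact mul_le_mul (hlX ω) hle hl.le hx.le
  have h3 : (X ω * e)⁻¹ ≤ (l ^ 2)⁻¹ := inv_anti₀ (by positivity) h2
  simp only [Pi.pow_apply, Pi.inv_apply, ← he]
  rw [h1, mul_pow]
  calc (e - X ω) ^ 2 * (X ω * e)⁻¹ ^ 2 ≤ (e - X ω) ^ 2 * (l ^ 2)⁻¹ ^ 2 := by
        gcongr
    _ = (l ^ 4)⁻¹ * (X ω - e) ^ 2 := by rw [← inv_pow, ← inv_pow]; ring

end Variance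

section Pointwise

variable {Ω : Type*}

lemma fdp_eq (c : ℕ → ℝ) (I₀ : Finset (Fin m)) (p : Fin m → Ω → ℝ) (ω : Ω) :
    fdp c I₀ (fun i => p i ω) = falseRej c p I₀ ∅ ω * (rej c p ∅ ω : ℝ)⁻¹ := by
  simp only [fdp, numFalseRejections, falseRej, rej, zeroOn_empty, Finset.sdiff_empty,
    div_eq_mul_inv]

lemma numRejectionsSubst_eq (c : ℕ → ℝ) (I₀ : Finset (Fin m)) (j : ℕ) (p : Fin m → Ω → ℝ)
    (ω : Ω) : numRejectionsSubst c I₀ j (fun i => p i ω) = rej c p (firstNulls I₀ j) ω := by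
  simp only [numRejectionsSubst, substPValues_eq_zeroOn, rej]

end Pointwise

/-! ### Moments of the false discovery proportion -/

section Moments

variable {Ω : Type*} [MeasurableSpace Ω] {P : Measure Ω} [IsProbabilityMeasure P]
  {p : Fin m → Ω → ℝ} {I₀ : Finset (Fin m)} {c : ℕ → ℝ} {α a b : ℝ}

lemma measurable_falseRej (hc : c 0 = 0) (hp : ∀ i, Measurable (p i)) (T : Finset (Fin m)) :
    Measurable (falseRej c p I₀ T) := by
  unfold falseRej
  simp only [Finset.card_filter]
  exact Finset.measurable_sum _ fun k _ =>
    Measurable.ite (measurableSet_le_rej hc hp T k) measurable_const measurable_const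

lemma measurable_fdp (hc : c 0 = 0) (hp : ∀ i, Measurable (p i)) :
    Measurable fun ω => fdp c I₀ (fun i => p i ω) := by
  simp only [fdp_eq]
  exact (measurable_from_top.comp (measurable_falseRej hc hp ∅)).mul
    (measurable_from_top (f := fun n : ℕ => (n : ℝ)⁻¹) |>.comp (measurable_rej hc hp ∅))

/-- If `k` values lie below `c R`, then `k ≥ R`, so they also lie below `c k`. Thus `k` is feasible
and maximality of `R` gives `k ≤ R`. This is what bounds the false discovery proportion by `1`. -/
lemma countLE_crit_numRejections {c : ℕ → ℝ} (hc : IsCritical m c) (p : Fin m → ℝ) :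
    countLE p (c (numRejections c p)) ≤ numRejections c p := by
  have hle : countLE p (c (numRejections c p)) ≤ m := by
    simpa [countLE] using Finset.card_filter_le Finset.univ fun k => p k ≤ c (numRejections c p)
  refine le_numRejections hc.zero hle ?_
  have h := hc.mono _ _ (numRejections_mem hc.zero p).2 hle
  exact Finset.card_le_card fun k hk => by
    simp only [Finset.mem_filter, Finset.mem_univ, true_and] at hk ⊢
    exact hk.trans h

lemma fdp_mem_Icc {c : ℕ → ℝ} (hc : IsCritical m c) (I₀ : Finset (Fin m)) (p : Fin m → ℝ) :
    fdp c I₀ p ∈ Set.Icc (0 : ℝ) 1 := by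
  refine ⟨by unfold fdp; positivity, div_le_one_of_le₀ ?_ (Nat.cast_nonneg _)⟩
  exact_mod_cast (Finset.card_le_card (Finset.filter_subset_filter _
    (Finset.subset_univ I₀))).trans (countLE_crit_numRejections hc p)

lemma card_nulls_le (I₀ : Finset (Fin m)) : I₀.card ≤ m := by
  simpa using Finset.card_le_univ I₀

lemma firstNulls_succ_nonempty {j : ℕ} (hj : j < I₀.card) : (firstNulls I₀ (j + 1)).Nonempty := by
  obtain ⟨-, x, -, h⟩ := firstNulls_succ I₀ hj
  rw [h]; exact Finset.insert_nonempty _ _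

/-- `E(FDP) = α E(ζ⁻¹)`. -/
lemma BasicIndependence.integral_fdp (h : BasicIndependence P p I₀) (hα : 0 < α)
    (hab : AdmissibleParams α a b) :
    ∫ ω, fdp (critVal α a b m) I₀ (fun i => p i ω) ∂P =
      α * ∫ ω, (normDenom a b m I₀.card
        (rej (critVal α a b m) p (firstNulls I₀ 1) ω))⁻¹ ∂P := by
  have hm₀ : 0 < I₀.card := Finset.card_pos.2 h.nonempty_trueNulls
  have hm := hm₀.trans_le (card_nulls_le I₀)
  have hc := isCritical_critVal (m := m) hα hm hab
  have h1 := h.integral_falseRej_mul hc (j := 0) hm₀ fun r => (r : ℝ)⁻¹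
  simp only [firstNulls_zero, zero_add, Nat.cast_zero, sub_zero] at h1
  simp only [fdp_eq]
  rw [h1, ← integral_const_mul, ← integral_const_mul]
  refine integral_congr_ae (ae_of_all _ fun ω => ?_)
  exact critVal_mul_inv hab hα (rej_le hc.zero _ ω)
    (numRejections_zeroOn_pos hc _ (firstNulls_succ_nonempty hm₀)) hm₀ (card_nulls_le I₀)

lemma BasicIndependence.integral_fdp_sq (h : BasicIndependence P p I₀) (hα : 0 < α)
    (hab : AdmissibleParams α a b) (h2 : 2 ≤ I₀.card) :
    ∫ ω, fdp (critVal α a b m) I₀ (fun i => p i ω) ^ 2 ∂P =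
      α * ∫ ω, (normDenom a b m I₀.card (rej (critVal α a b m) p (firstNulls I₀ 1) ω))⁻¹ *
        (rej (critVal α a b m) p (firstNulls I₀ 1) ω : ℝ)⁻¹ ∂P +
      α ^ 2 * (1 - (I₀.card : ℝ)⁻¹) * ∫ ω, (normDenom a b m I₀.card
        (rej (critVal α a b m) p (firstNulls I₀ 2) ω))⁻¹ ^ 2 ∂P := by
  have hm₀ : 0 < I₀.card := by omega
  have hm₀' : (0 : ℝ) < I₀.card := by exact_mod_cast hm₀
  have hm := hm₀.trans_le (card_nulls_le I₀)
  have hc := isCritical_critVal (m := m) hα hm hab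
  have h1 := h.integral_falseRej_sq_mul hc h2 fun r => (r : ℝ)⁻¹ ^ 2
  simp only [fdp_eq, mul_pow]
  rw [h1]
  congr 1
  · rw [← integral_const_mul, ← integral_const_mul]
    refine integral_congr_ae (ae_of_all _ fun ω => ?_)
    have := critVal_mul_inv hab hα (rej_le (p := p) hc.zero (firstNulls I₀ 1) ω)
      (numRejections_zeroOn_pos hc _ (firstNulls_succ_nonempty hm₀)) hm₀ (card_nulls_le I₀)
    simp only
    rw [← mul_assoc α, ← this]
    ring
  · rw [← integral_const_mul, ← integral_const_mul]
    refine integral_congr_ae (ae_of_all _ fun ω => ?_)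
    have := critVal_mul_inv hab hα (rej_le (p := p) hc.zero (firstNulls I₀ 2) ω)
      (numRejections_zeroOn_pos hc _ (firstNulls_succ_nonempty (j := 1) (by omega))) hm₀
      (card_nulls_le I₀)
    simp only
    -- The factor `1 - 1/m₀` is `m₀ (m₀ - 1)` pairs divided by the `m₀²` absorbed into `(α/ζ)²`.
    have h3 : ∀ x : ℝ, α ^ 2 * (1 - (I₀.card : ℝ)⁻¹) * x ^ 2 =
      (1 - (I₀.card : ℝ)⁻¹) * (α * x) ^ 2 := fun x => by ring
    rw [h3, ← this]
    field_simp

/-- The variance formula for the false discovery proportion. -/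
lemma BasicIndependence.variance_fdp (h : BasicIndependence P p I₀) (hα : 0 < α)
    (hab : AdmissibleParams α a b) (h2 : 2 ≤ I₀.card) :
    Var[fun ω => fdp (critVal α a b m) I₀ (fun i => p i ω); P] =
      α * ∫ ω, (normDenom a b m I₀.card (rej (critVal α a b m) p (firstNulls I₀ 1) ω))⁻¹ *
        (rej (critVal α a b m) p (firstNulls I₀ 1) ω : ℝ)⁻¹ ∂P +
      α ^ 2 * ∫ ω, ((normDenom a b m I₀.card
          (rej (critVal α a b m) p (firstNulls I₀ 2) ω))⁻¹ ^ 2 -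
        (normDenom a b m I₀.card (rej (critVal α a b m) p (firstNulls I₀ 1) ω))⁻¹ ^ 2) ∂P +
      α ^ 2 * Var[fun ω => (normDenom a b m I₀.card
        (rej (critVal α a b m) p (firstNulls I₀ 1) ω))⁻¹; P] -
      α ^ 2 * (I₀.card : ℝ)⁻¹ * ∫ ω, (normDenom a b m I₀.card
        (rej (critVal α a b m) p (firstNulls I₀ 2) ω))⁻¹ ^ 2 ∂P := by
  have hm₀ : 0 < I₀.card := by omega
  have hm := hm₀.trans_le (card_nulls_le I₀)
  have hc := isCritical_critVal (m := m) hα hm hab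
  have hint : ∀ T, ∀ g : ℕ → ℝ, Integrable (fun ω => g (rej (critVal α a b m) p T ω)) P :=
    fun T g => integrable_rej hc.zero h.measurable T g
  have hF : MemLp (fun ω => fdp (critVal α a b m) I₀ (fun i => p i ω)) 2 P :=
    MemLp.of_bound (measurable_fdp hc.zero h.measurable).aestronglyMeasurable 1
      (ae_of_all _ fun ω => by
        have := fdp_mem_Icc hc I₀ fun i => p i ω
        rw [Real.norm_eq_abs, abs_of_nonneg this.1]; exact this.2)
  have hZ : MemLp (fun ω => (normDenom a b m I₀.card
      (rej (critVal α a b m) p (firstNulls I₀ 1) ω))⁻¹) 2 P := by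
    refine (memLp_two_iff_integrable_sq (hint _ fun r =>
      (normDenom a b m I₀.card r)⁻¹).aestronglyMeasurable).2 ?_
    exact hint _ fun r => (normDenom a b m I₀.card r)⁻¹ ^ 2
  rw [variance_eq_sub hF, variance_eq_sub hZ]
  simp only [Pi.pow_apply]
  rw [h.integral_fdp_sq hα hab h2, h.integral_fdp hα hab,
    integral_sub (hint _ fun r => (normDenom a b m I₀.card r)⁻¹ ^ 2)
      (hint _ fun r => (normDenom a b m I₀.card r)⁻¹ ^ 2)]
  ring

/-- Elementary two-sided comparison of `ζ₂⁻² - ζ₁⁻²` and `ζ₁ - ζ₂`. -/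
lemma inv_sq_sub_inv_sq_bounds {l u x y : ℝ} (hl : 0 < l) (hlx : l ≤ x) (hxy : x ≤ y)
    (hyu : y ≤ u) :
    (y - x) * (2 * u⁻¹ ^ 3) ≤ x⁻¹ ^ 2 - y⁻¹ ^ 2 ∧
      x⁻¹ ^ 2 - y⁻¹ ^ 2 ≤ (y - x) * (2 * l⁻¹ ^ 3) := by
  have hx : 0 < x := hl.trans_le hlx
  have hy : 0 < y := hx.trans_le hxy
  have hu : 0 < u := hy.trans_le hyu
  have h1 : x⁻¹ ^ 2 - y⁻¹ ^ 2 = (y - x) * (x⁻¹ * y⁻¹ * (x⁻¹ + y⁻¹)) := by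
    field_simp; ring
  have h2 : x⁻¹ ≤ l⁻¹ := inv_anti₀ hl hlx
  have h3 : y⁻¹ ≤ l⁻¹ := inv_anti₀ hl (hlx.trans hxy)
  have h4 : u⁻¹ ≤ x⁻¹ := inv_anti₀ hx (hxy.trans hyu)
  have h5 : u⁻¹ ≤ y⁻¹ := inv_anti₀ hy hyu
  have hyx : 0 ≤ y - x := sub_nonneg.2 hxy
  rw [h1]
  constructor
  · refine mul_le_mul_of_nonneg_left ?_ hyx
    calc 2 * u⁻¹ ^ 3 = u⁻¹ * u⁻¹ * (u⁻¹ + u⁻¹) := by ring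
      _ ≤ _ := by gcongr
  · refine mul_le_mul_of_nonneg_left ?_ hyx
    calc x⁻¹ * y⁻¹ * (x⁻¹ + y⁻¹) ≤ l⁻¹ * l⁻¹ * (l⁻¹ + l⁻¹) := by gcongr
      _ = _ := by ring

/-- Upper and lower bounds for the variance of the false discovery proportion in terms of the
three quantities that govern consistency. -/
lemma BasicIndependence.variance_fdp_bounds (h : BasicIndependence P p I₀) (hα : 0 < α)
    (hab : AdmissibleParams α a b) (h2 : 2 ≤ I₀.card) {K : ℝ}
    (hK : ((m : ℝ) + b) / I₀.card ≤ K) {V A B C : ℝ}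
    (hV : V = Var[fun ω => fdp (critVal α a b m) I₀ (fun i => p i ω); P])
    (hA : A = ∫ ω, (rej (critVal α a b m) p (firstNulls I₀ 1) ω : ℝ)⁻¹ ∂P)
    (hB : B = ∫ ω, a / m * ((rej (critVal α a b m) p (firstNulls I₀ 2) ω : ℝ) -
      rej (critVal α a b m) p (firstNulls I₀ 1) ω) ∂P)
    (hC : C = Var[fun ω => normDenom a b m I₀.card
      (rej (critVal α a b m) p (firstNulls I₀ 1) ω); P]) :
    V ≤ A + 2 * K * α⁻¹ * B + α⁻¹ ^ 2 * C ∧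
      A ≤ K * α⁻¹ * (V + (I₀.card : ℝ)⁻¹) ∧
      B ≤ K ^ 3 * (2 * α ^ 2)⁻¹ * (V + (I₀.card : ℝ)⁻¹) ∧
      C ≤ K ^ 4 * α⁻¹ ^ 2 * (V + (I₀.card : ℝ)⁻¹) := by
  have hm₀ : 0 < I₀.card := by omega
  have hm := hm₀.trans_le (card_nulls_le I₀)
  have hm₀' : (0 : ℝ) < I₀.card := by exact_mod_cast hm₀
  have hm' : (0 : ℝ) < m := by exact_mod_cast hm
  have hc := isCritical_critVal (m := m) hα hm hab
  have hint : ∀ T, ∀ g : ℕ → ℝ, Integrable (fun ω => g (rej (critVal α a b m) p T ω)) P :=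
    fun T g => integrable_rej hc.zero h.measurable T g
  have hmeas : ∀ T, ∀ g : ℕ → ℝ, Measurable (fun ω => g (rej (critVal α a b m) p T ω)) :=
    fun T g => Measurable.of_discrete.comp (measurable_rej hc.zero h.measurable T)
  set R₁ := rej (critVal α a b m) p (firstNulls I₀ 1) with hR₁
  set R₂ := rej (critVal α a b m) p (firstNulls I₀ 2) with hR₂
  set ζ := normDenom a b m I₀.card with hζ
  have hζl : ∀ r ≤ m, α ≤ ζ r := fun r hr => le_normDenom hab hα hr hm₀ (card_nulls_le I₀)
  have hζu : ∀ r, ζ r ≤ K := fun r => normDenom_le hab hK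
  have hR₁m : ∀ ω, R₁ ω ≤ m := fun ω => rej_le hc.zero _ ω
  have hR₂m : ∀ ω, R₂ ω ≤ m := fun ω => rej_le hc.zero _ ω
  have hR₁1 : ∀ ω, 1 ≤ R₁ ω := fun ω =>
    numRejections_zeroOn_pos hc _ (firstNulls_succ_nonempty hm₀)
  have hR₁₂ : ∀ ω, R₁ ω ≤ R₂ ω := fun ω => by
    obtain ⟨-, y, -, hT2⟩ := firstNulls_succ I₀ (j := 1) (by omega)
    refine numRejections_zeroOn_mono hc.zero (fun i => (h.mem_Icc i ω).1) ?_
    rw [hT2]; exact Finset.subset_insert _ _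
  have hαK : α ≤ K := (hζl 0 (Nat.zero_le _)).trans (hζu 0)
  have hK0 : 0 < K := hα.trans_le hαK
  have hmK : (m : ℝ) / I₀.card ≤ K := le_trans (by
    gcongr; linarith [hab.nonneg_right]) hK
  have hm1 : 1 ≤ (m : ℝ) / I₀.card := by
    rw [one_le_div hm₀']; exact_mod_cast card_nulls_le I₀
  -- the three nonnegative terms of the variance formula
  have hvar := h.variance_fdp hα hab h2
  simp only [← hR₁, ← hR₂, ← hζ, ← hV] at hvar
  set A' := ∫ ω, (ζ (R₁ ω))⁻¹ * (R₁ ω : ℝ)⁻¹ ∂P with hA'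
  set B' := ∫ ω, ((ζ (R₂ ω))⁻¹ ^ 2 - (ζ (R₁ ω))⁻¹ ^ 2) ∂P with hB'
  set C' := Var[fun ω => (ζ (R₁ ω))⁻¹; P] with hC'
  set D' := ∫ ω, (ζ (R₂ ω))⁻¹ ^ 2 ∂P with hD'
  have hiA' : Integrable (fun ω => (ζ (R₁ ω))⁻¹ * (R₁ ω : ℝ)⁻¹) P :=
    hint _ fun r => (ζ r)⁻¹ * (r : ℝ)⁻¹
  have hiA : Integrable (fun ω => (R₁ ω : ℝ)⁻¹) P := hint _ fun r => (r : ℝ)⁻¹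
  have hiB' : Integrable (fun ω => (ζ (R₂ ω))⁻¹ ^ 2 - (ζ (R₁ ω))⁻¹ ^ 2) P :=
    (hint _ fun r => (ζ r)⁻¹ ^ 2).sub (hint _ fun r => (ζ r)⁻¹ ^ 2)
  have hiB : Integrable (fun ω => a / m * ((R₂ ω : ℝ) - R₁ ω)) P :=
    ((hint _ fun r => (r : ℝ)).sub (hint _ fun r => (r : ℝ))).const_mul _
  have hA1 : A' ≤ α⁻¹ * A := by
    rw [hA, ← integral_const_mul]
    refine integral_mono hiA' (hiA.const_mul _) fun ω => ?_
    have := inv_anti₀ hα (hζl _ (hR₁m ω))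
    simp only
    gcongr
  have hA2 : A ≤ K * A' := by
    rw [hA, ← integral_const_mul]
    refine integral_mono hiA (hiA'.const_mul _) fun ω => ?_
    have h3 : 0 < ζ (R₁ ω) := hα.trans_le (hζl _ (hR₁m ω))
    have h4 : 1 ≤ K * (ζ (R₁ ω))⁻¹ := by
      rw [← div_eq_mul_inv, one_le_div h3]; exact hζu _
    simp only
    rw [← mul_assoc]
    exact le_mul_of_one_le_left (by positivity) h4
  -- Links the second term of the variance to `B`; the factor `m / m₀` lies between `1` and `K`.
  have hdiff : ∀ ω, ζ (R₁ ω) - ζ (R₂ ω) =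
      (m : ℝ) / I₀.card * (a / m * ((R₂ ω : ℝ) - R₁ ω)) := fun ω => by
    simp only [hζ, normDenom]; field_simp; ring
  have hX0 : ∀ ω, 0 ≤ a / m * ((R₂ ω : ℝ) - R₁ ω) := fun ω =>
    mul_nonneg (div_nonneg hab.nonneg hm'.le) (sub_nonneg.2 (by exact_mod_cast hR₁₂ ω))
  have hζ₁₂ : ∀ ω, ζ (R₂ ω) ≤ ζ (R₁ ω) := fun ω => by
    rw [← sub_nonneg, hdiff]; exact mul_nonneg (by positivity) (hX0 ω)
  have hBb : ∀ ω, _ := fun ω => inv_sq_sub_inv_sq_bounds hα (hζl _ (hR₂m ω)) (hζ₁₂ ω)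
    (hζu (R₁ ω))
  have hB1 : B' ≤ 2 * K * α⁻¹ ^ 3 * B := by
    rw [hB, ← integral_const_mul]
    refine integral_mono hiB' (hiB.const_mul _) fun ω => ?_
    refine (hBb ω).2.trans ?_
    rw [hdiff]
    calc _ ≤ K * (a / m * ((R₂ ω : ℝ) - R₁ ω)) * (2 * α⁻¹ ^ 3) := by
          have := hX0 ω
          gcongr
      _ = _ := by ring
  have hB2 : B ≤ K ^ 3 / 2 * B' := by
    rw [hB, ← integral_const_mul]
    refine integral_mono hiB (hiB'.const_mul _) fun ω => ?_
    have h3 := (hBb ω).1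
    calc a / m * ((R₂ ω : ℝ) - R₁ ω) ≤ ζ (R₁ ω) - ζ (R₂ ω) := by
          rw [hdiff]; exact le_mul_of_one_le_left (hX0 ω) hm1
      _ = K ^ 3 / 2 * ((ζ (R₁ ω) - ζ (R₂ ω)) * (2 * K⁻¹ ^ 3)) := by field_simp
      _ ≤ _ := by gcongr
  have hC1 : C' ≤ α⁻¹ ^ 4 * C := by
    rw [hC, inv_pow]
    exact variance_inv_le (hmeas _ ζ) hα (fun ω => hζl _ (hR₁m ω)) fun ω => hζu _
  -- The reciprocal bound again, now applied to `1/ζ`, which is bounded below by `1/K`.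
  have hC2 : C ≤ K ^ 4 * C' := by
    have h3 := variance_inv_le (P := P) (X := fun ω => (ζ (R₁ ω))⁻¹) (hmeas _ fun r => (ζ r)⁻¹)
      (inv_pos.2 hK0)
      (fun ω => inv_anti₀ (hα.trans_le (hζl _ (hR₁m ω))) (hζu _))
      (fun ω => inv_anti₀ hα (hζl _ (hR₁m ω)))
    simp only [inv_inv, inv_pow] at h3
    rw [hC]; exact h3
  have hA0 : 0 ≤ A' := integral_nonneg fun ω => by
    have := hα.trans_le (hζl _ (hR₁m ω))
    positivity
  have hB0 : 0 ≤ B' := integral_nonneg fun ω =>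
    le_trans (mul_nonneg (sub_nonneg.2 (hζ₁₂ ω)) (by positivity)) (hBb ω).1
  have hC0 : 0 ≤ C' := variance_nonneg _ _
  have hD0 : 0 ≤ D' := integral_nonneg fun ω => by positivity
  have hD1 : D' ≤ α⁻¹ ^ 2 := by
    have := integral_mono (μ := P) (hint (firstNulls I₀ 2) fun r => (ζ r)⁻¹ ^ 2)
      (integrable_const (α⁻¹ ^ 2)) fun ω => by
        have h3 := inv_anti₀ hα (hζl _ (hR₂m ω))
        have h4 := inv_nonneg.2 (hα.le.trans (hζl _ (hR₂m ω)))
        exact pow_le_pow_left₀ h4 h3 2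
    rwa [integral_const, probReal_univ, one_smul] at this
  have hDm : α ^ 2 * (I₀.card : ℝ)⁻¹ * D' ≤ (I₀.card : ℝ)⁻¹ := by
    calc α ^ 2 * (I₀.card : ℝ)⁻¹ * D' ≤ α ^ 2 * (I₀.card : ℝ)⁻¹ * α⁻¹ ^ 2 := by gcongr
      _ = _ := by field_simp
  have hDm0 : 0 ≤ α ^ 2 * (I₀.card : ℝ)⁻¹ * D' := by positivity
  have eA : 0 ≤ α * A' := by positivity
  have eB : 0 ≤ α ^ 2 * B' := by positivity
  have eC : 0 ≤ α ^ 2 * C' := by positivity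
  refine ⟨?_, ?_, ?_, ?_⟩
  · have f1 : α * A' ≤ A := by
      calc α * A' ≤ α * (α⁻¹ * A) := by gcongr
        _ = A := by field_simp
    have f2 : α ^ 2 * B' ≤ 2 * K * α⁻¹ * B := by
      calc α ^ 2 * B' ≤ α ^ 2 * (2 * K * α⁻¹ ^ 3 * B) := by gcongr
        _ = _ := by field_simp
    have f3 : α ^ 2 * C' ≤ α⁻¹ ^ 2 * C := by
      calc α ^ 2 * C' ≤ α ^ 2 * (α⁻¹ ^ 4 * C) := by gcongr
        _ = _ := by field_simp
    linarith
  · calc A ≤ K * A' := hA2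
      _ = K * α⁻¹ * (α * A') := by field_simp
      _ ≤ _ := by gcongr; linarith
  · calc B ≤ K ^ 3 / 2 * B' := hB2
      _ = K ^ 3 * (2 * α ^ 2)⁻¹ * (α ^ 2 * B') := by field_simp
      _ ≤ _ := by gcongr; linarith
  · calc C ≤ K ^ 4 * C' := hC2
      _ = K ^ 4 * α⁻¹ ^ 2 * (α ^ 2 * C') := by field_simp
      _ ≤ _ := by gcongr; linarith

/-- Recursion for the probabilities that at least a fraction `δ` of all hypotheses is rejected. -/
lemma BasicIndependence.measureReal_le_rej (h : BasicIndependence P p I₀) (hα : 0 < α)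
    (hab : AdmissibleParams α a b) {j : ℕ} (hj : j < I₀.card) {δ A : ℝ} (hδ : 0 < δ)
    (haA : a ≤ A) (hA : A < 1) :
    P.real {ω | δ * m ≤ rej (critVal α a b m) p (firstNulls I₀ j) ω} ≤
      α / (1 - A) *
        P.real {ω | δ * m ≤ rej (critVal α a b m) p (firstNulls I₀ (j + 1)) ω} +
      ((I₀ᶜ.card : ℝ) + j) / (δ * m) := by
  have hm₀ : 0 < I₀.card := by omega
  have hm := hm₀.trans_le (card_nulls_le I₀)
  have hm' : (0 : ℝ) < m := by exact_mod_cast hm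
  have hc := isCritical_critVal (m := m) hα hm hab
  have hδm : 0 < δ * m := mul_pos hδ hm'
  have hA1 : 0 < 1 - A := sub_pos.2 hA
  -- The weight `1/r`, cut off below `δ m`, compares the number of false rejections with the number
  -- of all rejections.
  let g : ℕ → ℝ := fun r => if δ * m ≤ r then (r : ℝ)⁻¹ else 0
  let q : ℕ → ℝ := fun r => if δ * m ≤ r then 1 else 0
  have hq : ∀ T, P.real {ω | δ * m ≤ rej (critVal α a b m) p T ω} =
      ∫ ω, q (rej (critVal α a b m) p T ω) ∂P := by
    intro T
    have hs : MeasurableSet {ω | δ * m ≤ rej (critVal α a b m) p T ω} :=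
      measurableSet_le measurable_const
        (measurable_from_top.comp (measurable_rej hc.zero h.measurable T))
    rw [← integral_indicator_one hs]
    refine integral_congr_ae (ae_of_all _ fun ω => ?_)
    simp [q, Set.indicator]
  have hint : ∀ T, ∀ g : ℕ → ℝ, Integrable (fun ω => g (rej (critVal α a b m) p T ω)) P :=
    fun T g => integrable_rej hc.zero h.measurable T g
  have key := h.integral_falseRej_mul hc hj g
  obtain ⟨hcard, -⟩ := firstNulls_succ I₀ hj
  -- When `R ≥ δ m`, all but `m₁ + j` of the rejections are nulls outside the zeroed set, so their
  -- share is at least `1 - (m₁ + j)/(δ m)`.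
  have hlow : (∫ ω, q (rej (critVal α a b m) p (firstNulls I₀ j) ω) ∂P) -
      ((I₀ᶜ.card : ℝ) + j) / (δ * m) ≤
      ∫ ω, (falseRej (critVal α a b m) p I₀ (firstNulls I₀ j) ω : ℝ) *
        g (rej (critVal α a b m) p (firstNulls I₀ j) ω) ∂P := by
    have hi : Integrable (fun ω => (falseRej (critVal α a b m) p I₀ (firstNulls I₀ j) ω : ℝ) *
        g (rej (critVal α a b m) p (firstNulls I₀ j) ω)) P := by
      simp only [falseRej_mul]
      exact integrable_finsetSum _ fun i _ => integrable_ite_rej hc.zero h.measurable _ g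
        (measurableSet_le_rej hc.zero h.measurable _ i)
    have := integral_mono ((hint (firstNulls I₀ j) q).sub
      (integrable_const (((I₀ᶜ.card : ℝ) + j) / (δ * m)))) hi fun ω => ?_
    · rw [integral_sub' (hint (firstNulls I₀ j) q) (integrable_const _)] at this
      simpa using this
    · simp only [Pi.sub_apply, q, g]
      have hle : ((rej (critVal α a b m) p (firstNulls I₀ j) ω : ℕ) : ℝ) ≤
          falseRej (critVal α a b m) p I₀ (firstNulls I₀ j) ω + ((I₀ᶜ.card : ℝ) + j) := by
        have := numRejections_le_add hc.zero (fun i => p i ω) I₀ (firstNulls I₀ j)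
        rw [hcard] at this
        exact_mod_cast this
      split_ifs with hr
      · have hr0 : (0 : ℝ) < rej (critVal α a b m) p (firstNulls I₀ j) ω := hδm.trans_le hr
        have h3 : ((I₀ᶜ.card : ℝ) + j) * (rej (critVal α a b m) p (firstNulls I₀ j) ω : ℝ)⁻¹ ≤
            ((I₀ᶜ.card : ℝ) + j) / (δ * m) := by
          rw [div_eq_mul_inv]
          have := inv_anti₀ hδm hr
          gcongr
        have h4 : 1 ≤ (falseRej (critVal α a b m) p I₀ (firstNulls I₀ j) ω +
            ((I₀ᶜ.card : ℝ) + j)) * (rej (critVal α a b m) p (firstNulls I₀ j) ω : ℝ)⁻¹ := by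
          rw [← div_eq_mul_inv, one_le_div hr0]; exact hle
        linarith
      · have : 0 ≤ ((I₀ᶜ.card : ℝ) + j) / (δ * m) := by positivity
        simpa using this
  -- Here `m₀ - j ≤ m`, while `a ≤ A` keeps the denominator above `(1 - A) m`.
  have hup : ((I₀.card : ℝ) - j) *
      ∫ ω, critVal α a b m (rej (critVal α a b m) p (firstNulls I₀ (j + 1)) ω) *
        g (rej (critVal α a b m) p (firstNulls I₀ (j + 1)) ω) ∂P ≤
      α / (1 - A) * ∫ ω, q (rej (critVal α a b m) p (firstNulls I₀ (j + 1)) ω) ∂P := by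
    rw [← integral_const_mul, ← integral_const_mul]
    refine integral_mono ((hint _ fun r => critVal α a b m r * g r).const_mul _)
      ((hint _ q).const_mul _) fun ω => ?_
    simp only [g, q]
    split_ifs with hr
    · set r := rej (critVal α a b m) p (firstNulls I₀ (j + 1)) ω with hrdef
      have hr0 : (0 : ℝ) < r := hδm.trans_le hr
      have hrm : (r : ℝ) ≤ m := by exact_mod_cast rej_le hc.zero (firstNulls I₀ (j + 1)) ω
      have hden : (1 - A) * m ≤ (m : ℝ) + b - a * r := by
        have h3 : a * r ≤ A * m := mul_le_mul haA hrm hr0.le (hab.nonneg.trans haA)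
        nlinarith [hab.nonneg_right]
      have hd0 : 0 < (m : ℝ) + b - a * r := (mul_pos hA1 hm').trans_le hden
      have hcr : critVal α a b m r * (r : ℝ)⁻¹ = α / ((m : ℝ) + b - a * r) := by
        unfold critVal; field_simp
      rw [hcr, mul_one]
      have hm₀m : (I₀.card : ℝ) - j ≤ m := by
        have : (I₀.card : ℝ) ≤ m := by exact_mod_cast card_nulls_le I₀
        linarith [(Nat.cast_nonneg j : (0 : ℝ) ≤ j)]
      calc ((I₀.card : ℝ) - j) * (α / ((m : ℝ) + b - a * r))
          ≤ m * (α / ((1 - A) * m)) := by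
            refine mul_le_mul hm₀m ?_ (by positivity) hm'.le
            gcongr
        _ = α / (1 - A) := by field_simp
    · simp
  rw [hq, hq]
  linarith

end Moments
end StepUp

namespace StepUp

/-! ### Convergence in probability of bounded variables via moments -/

section InProbability

variable {Ω : ℕ → Type*} [∀ m, MeasurableSpace (Ω m)] {P : ∀ m, Measure (Ω m)}
  [∀ m, IsProbabilityMeasure (P m)]

lemma tendsto_measure_iff_measureReal {s : ∀ m, Set (Ω m)} :
    Tendsto (fun m => P m (s m)) atTop (𝓝 0) ↔ Tendsto (fun m => (P m).real (s m)) atTop (𝓝 0) := by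
  have := ENNReal.tendsto_toReal_iff (fi := atTop)
    (fun m => measure_ne_top (P m) (s m)) ENNReal.zero_ne_top
  exact this.symm

/-- For bounded variables, convergence to `0` in probability is convergence in `L¹`. -/
lemma tendstoInProb_zero_iff_integral_abs {X : ∀ m, Ω m → ℝ} {C : ℝ}
    (hX : ∀ᶠ m in atTop, Measurable (X m)) (hC : ∀ᶠ m in atTop, ∀ ω, |X m ω| ≤ C) :
    TendstoInProb P X 0 ↔ Tendsto (fun m => ∫ ω, |X m ω| ∂(P m)) atTop (𝓝 0) := by
  have hint : ∀ᶠ m in atTop, Integrable (fun ω => |X m ω|) (P m) := by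
    filter_upwards [hX, hC] with m h1 h2
    exact (Integrable.of_bound h1.aestronglyMeasurable C (ae_of_all _ h2)).abs
  simp only [TendstoInProb, sub_zero, tendsto_measure_iff_measureReal]
  constructor
  · intro h
    have hC0 : 0 ≤ max C 0 := le_max_right _ _
    refine tendsto_order.2 ⟨fun y hy => Eventually.of_forall fun m =>
      hy.trans_le (integral_nonneg fun ω => abs_nonneg _), fun ε hε => ?_⟩
    have h1 := (h (ε / 2) (by positivity)).const_mul (max C 0)
    rw [mul_zero] at h1
    filter_upwards [hX, hC, hint, h1.eventually (gt_mem_nhds (half_pos hε))] with m hXm hCm him hlt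
    have hs : MeasurableSet {ω | ε / 2 ≤ |X m ω|} := measurableSet_le measurable_const hXm.abs
    -- Splits according to whether `|X|` reaches `ε / 2`; `max C 0` serves as a bound whose sign is
    -- known.
    have h2 : ∫ ω, |X m ω| ∂(P m) ≤
        ∫ ω, (ε / 2 + {ω | ε / 2 ≤ |X m ω|}.indicator (fun _ => max C 0) ω) ∂(P m) := by
      refine integral_mono him ((integrable_const _).add ((integrable_const _).indicator hs))
        fun ω => ?_
      by_cases hω : ε / 2 ≤ |X m ω|
      · simp only [Set.indicator, Set.mem_ofPred_eq, hω, if_true]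
        linarith [hCm ω, le_max_left C 0]
      · simp only [Set.indicator, Set.mem_ofPred_eq, hω, if_false]
        linarith [not_le.1 hω]
    rw [integral_add (integrable_const _) ((integrable_const _).indicator hs),
      integral_indicator hs, setIntegral_const, integral_const, probReal_univ] at h2
    simp only [smul_eq_mul, one_mul] at h2
    linarith [mul_comm (max C 0) ((P m).real {ω | ε / 2 ≤ |X m ω|})]
  · intro h ε hε
    have h1 := h.const_mul ε⁻¹
    rw [mul_zero] at h1
    refine squeeze_zero' (Eventually.of_forall fun m => measureReal_nonneg) ?_ h1
    filter_upwards [hint] with m hm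
    have := mul_meas_ge_le_integral_of_nonneg (ae_of_all _ fun ω => abs_nonneg (X m ω)) hm ε
    rw [inv_mul_eq_div, le_div_iff₀ hε, mul_comm]
    exact this

lemma tendstoInProb_zero_iff_integral_sq {X : ∀ m, Ω m → ℝ} {C : ℝ}
    (hX : ∀ᶠ m in atTop, Measurable (X m)) (hC : ∀ᶠ m in atTop, ∀ ω, |X m ω| ≤ C) :
    TendstoInProb P X 0 ↔ Tendsto (fun m => ∫ ω, X m ω ^ 2 ∂(P m)) atTop (𝓝 0) := by
  have h1 : TendstoInProb P X 0 ↔ TendstoInProb P (fun m ω => X m ω ^ 2) 0 := by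
    simp only [TendstoInProb, sub_zero]
    constructor
    · intro h ε hε
      convert h (Real.sqrt ε) (Real.sqrt_pos.2 hε) using 4 with m
      ext ω
      rw [abs_of_nonneg (sq_nonneg (X m ω)), Real.sqrt_le_left (abs_nonneg _), sq_abs]
    · intro h ε hε
      convert h (ε ^ 2) (by positivity) using 4 with m
      ext ω
      rw [abs_of_nonneg (sq_nonneg (X m ω)), ← sq_abs (X m ω), pow_le_pow_iff_left₀ hε.le (abs_nonneg _)
        two_ne_zero]
  rw [h1, tendstoInProb_zero_iff_integral_abs (X := fun m ω => X m ω ^ 2) (C := C ^ 2)]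
  · simp only [abs_pow, sq_abs]
  · filter_upwards [hX] with m hm using hm.pow_const 2
  · filter_upwards [hC] with m hm ω
    rw [abs_pow]
    exact pow_le_pow_left₀ (abs_nonneg _) (hm ω) 2

/-- A bounded sequence concentrates around its mean iff its variance tends to `0`. -/
lemma tendstoInProb_sub_integral_iff_variance {X : ∀ m, Ω m → ℝ} {C : ℝ}
    (hX : ∀ᶠ m in atTop, Measurable (X m)) (hC : ∀ᶠ m in atTop, ∀ ω, |X m ω| ≤ C) :
    TendstoInProb P (fun m ω => X m ω - ∫ ω', X m ω' ∂(P m)) 0 ↔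
      Tendsto (fun m => Var[X m; P m]) atTop (𝓝 0) := by
  rw [tendstoInProb_zero_iff_integral_sq (C := 2 * C)]
  · refine tendsto_congr' ?_
    filter_upwards [hX] with m hm
    rw [variance_eq_integral hm.aemeasurable]
  · filter_upwards [hX] with m hm using hm.sub_const _
  · filter_upwards [hC] with m hm ω
    have h1 : ‖∫ ω', X m ω' ∂(P m)‖ ≤ C := by
      have := norm_integral_le_of_norm_le_const (μ := P m) (f := X m) (ae_of_all _ hm)
      simpa using this
    have h2 := abs_sub (X m ω) (∫ ω', X m ω' ∂(P m))
    rw [Real.norm_eq_abs] at h1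
    linarith [hm ω]

/-- Divergence of `N` is convergence of `1/N` to `0`, and `1/N` is bounded by `1`, so the `L¹`
criterion applies. -/
lemma tendstoInProbAtTop_iff_integral_inv {N : ∀ m, Ω m → ℕ}
    (hN : ∀ᶠ m in atTop, Measurable (N m)) (hN1 : ∀ᶠ m in atTop, ∀ ω, 1 ≤ N m ω) :
    TendstoInProbAtTop P (fun m ω => (N m ω : ℝ)) ↔
      Tendsto (fun m => ∫ ω, (N m ω : ℝ)⁻¹ ∂(P m)) atTop (𝓝 0) := by
  have h1 := tendstoInProb_zero_iff_integral_abs (P := P) (X := fun m ω => (N m ω : ℝ)⁻¹) (C := 1)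
    (by filter_upwards [hN] with m hm
        exact measurable_from_top (f := fun n : ℕ => (n : ℝ)⁻¹) |>.comp hm)
    (by filter_upwards [hN1] with m hm ω
        rw [abs_of_nonneg (by positivity)]
        exact inv_le_one_of_one_le₀ (by exact_mod_cast hm ω))
  have h2 : ∀ m ω, |(N m ω : ℝ)⁻¹| = (N m ω : ℝ)⁻¹ := fun m ω => abs_of_nonneg (by positivity)
  simp only [h2] at h1
  rw [← h1]
  simp only [TendstoInProb, TendstoInProbAtTop, sub_zero, h2]
  constructor
  · intro h ε hε
    refine (tendsto_congr' ?_).1 (h ε⁻¹)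
    filter_upwards [hN1] with m hm
    congr 1
    ext ω
    have : (0 : ℝ) < N m ω := by exact_mod_cast hm ω
    exact le_inv_comm₀ this hε
  · intro h K
    -- The level `K` may be nonpositive; enlarging it to `max K 1` makes it invertible and only
    -- enlarges the event.
    have hK : 0 < max K 1 := lt_max_of_lt_right one_pos
    refine tendsto_of_tendsto_of_tendsto_of_le_of_le' tendsto_const_nhds
      (h (max K 1)⁻¹ (inv_pos.2 hK)) (Eventually.of_forall fun m => zero_le) ?_
    filter_upwards [hN1] with m hm
    refine measure_mono fun ω hω => ?_
    have : (0 : ℝ) < N m ω := by exact_mod_cast hm ω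
    exact inv_anti₀ this (le_trans hω (le_max_left _ _))

end InProbability

/-! ### Vanishing fraction of rejections when `κ₀ = 1` -/

section Asymptotics

variable {Ω : ℕ → Type*} [∀ m, MeasurableSpace (Ω m)] {P : ∀ m, Measure (Ω m)}
  [∀ m, IsProbabilityMeasure (P m)] {p : ∀ m, Fin m → Ω m → ℝ} {I₀ : ∀ m, Finset (Fin m)}
  {α κ₀ : ℝ} {a b : ℕ → ℝ}

lemma tendsto_card_nulls (hκ : 0 < κ₀)
    (hA1 : Tendsto (fun m : ℕ => ((I₀ m).card : ℝ) / (m : ℝ)) atTop (𝓝 κ₀)) :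
    Tendsto (fun m : ℕ => ((I₀ m).card : ℝ)) atTop atTop := by
  refine (hA1.pos_mul_atTop hκ tendsto_natCast_atTop_atTop).congr' ?_
  filter_upwards [eventually_gt_atTop 0] with m hm
  have : (m : ℝ) ≠ 0 := by exact_mod_cast hm.ne'
  field_simp

lemma tendsto_normDenom_zero (hκ : 0 < κ₀)
    (hA1 : Tendsto (fun m : ℕ => ((I₀ m).card : ℝ) / (m : ℝ)) atTop (𝓝 κ₀))
    (hb : Tendsto (fun m : ℕ => b m / (m : ℝ)) atTop (𝓝 0)) :
    Tendsto (fun m : ℕ => ((m : ℝ) + b m) / (I₀ m).card) atTop (𝓝 κ₀⁻¹) := by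
  have h := (hb.const_add 1).div hA1 hκ.ne'
  rw [add_zero, one_div] at h
  refine h.congr' ?_
  filter_upwards [eventually_gt_atTop 0] with m hm
  have : (m : ℝ) ≠ 0 := by exact_mod_cast hm.ne'
  simp only [Pi.div_apply]
  field_simp

/-- If nearly all null hypotheses are true and `a` stays away from `1 - α`, then only a
vanishing fraction of all hypotheses is rejected. -/
lemma tendsto_measureReal_le_rej (hBI : ∀ m, 2 ≤ m → BasicIndependence (P m) (p m) (I₀ m))
    (hα : 0 < α) (hab : ∀ m, 2 ≤ m → AdmissibleParams α (a m) (b m))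
    (hA1 : Tendsto (fun m : ℕ => ((I₀ m).card : ℝ) / (m : ℝ)) atTop (𝓝 1))
    {A : ℝ} (hA : A < 1 - α) (haA : ∀ᶠ m in atTop, a m ≤ A) {δ : ℝ} (hδ : 0 < δ) (j : ℕ) :
    Tendsto (fun m => (P m).real {ω | δ * m ≤
      rej (critVal α (a m) (b m) m) (p m) (firstNulls (I₀ m) j) ω}) atTop (𝓝 0) := by
  set ρ := α / (1 - A) with hρ
  have hA1' : 0 < 1 - A := by linarith
  have hρ0 : 0 < ρ := by positivity
  have hρ1 : ρ < 1 := by rw [hρ, div_lt_one hA1']; linarith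
  have herr : ∀ j : ℕ, Tendsto (fun m : ℕ => (((I₀ m)ᶜ.card : ℝ) + j) / (δ * m)) atTop (𝓝 0) := by
    intro j
    have h1 := ((hA1.const_sub 1).add
      (tendsto_const_div_atTop_nhds_zero_nat (j : ℝ))).const_mul δ⁻¹
    simp only [sub_self, add_zero, mul_zero] at h1
    refine h1.congr' ?_
    filter_upwards [eventually_gt_atTop 0] with m hm
    have h2 : (m : ℝ) ≠ 0 := by exact_mod_cast hm.ne'
    have h3 : ((I₀ m)ᶜ.card : ℝ) = m - (I₀ m).card := by
      rw [Finset.card_compl, Fintype.card_fin, Nat.cast_sub (card_nulls_le _)]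
    rw [h3]
    field_simp
  have hcard := tendsto_card_nulls one_pos hA1
  -- Iterates the recursion `k` times. The statement quantifies over `j` since each step passes from
  -- `j` to `j + 1`; for fixed `j` this is possible once `m₀ > j`, hence for large `m`.
  have claim : ∀ k j : ℕ, ∀ ε > 0, ∀ᶠ m in atTop, (P m).real {ω | δ * m ≤
      rej (critVal α (a m) (b m) m) (p m) (firstNulls (I₀ m) j) ω} ≤ ρ ^ k + ε := by
    intro k
    induction k with
    | zero =>
      intro j ε hε
      refine Eventually.of_forall fun m => ?_
      have := measureReal_le_one (μ := P m) (s := {ω | δ * m ≤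
        rej (critVal α (a m) (b m) m) (p m) (firstNulls (I₀ m) j) ω})
      rw [pow_zero]
      linarith
    | succ k ih =>
      intro j ε hε
      filter_upwards [ih (j + 1) (ε / 2) (by positivity), (herr j).eventually
        (gt_mem_nhds (half_pos hε)), eventually_ge_atTop 2, haA,
        hcard.eventually_gt_atTop (j : ℝ)] with m h1 h2 h3 h4 h5
      have h6 := (hBI m h3).measureReal_le_rej hα (hab m h3) (j := j) (by exact_mod_cast h5) hδ h4
        (by linarith : A < 1)
      have h7 := mul_le_mul_of_nonneg_left h1 hρ0.le
      have h8 : ρ * (ρ ^ k + ε / 2) ≤ ρ ^ (k + 1) + ε / 2 := by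
        rw [pow_succ]; nlinarith
      linarith
  refine tendsto_order.2 ⟨fun y hy => Eventually.of_forall fun m =>
    hy.trans_le measureReal_nonneg, fun ε hε => ?_⟩
  obtain ⟨k, hk⟩ := exists_pow_lt_of_lt_one (half_pos hε) hρ1
  filter_upwards [claim k j (ε / 2) (by positivity)] with m hm
  linarith

lemma tendsto_integral_rej_div (hBI : ∀ m, 2 ≤ m → BasicIndependence (P m) (p m) (I₀ m))
    (hα : 0 < α) (hab : ∀ m, 2 ≤ m → AdmissibleParams α (a m) (b m))
    (hA1 : Tendsto (fun m : ℕ => ((I₀ m).card : ℝ) / (m : ℝ)) atTop (𝓝 1))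
    {A : ℝ} (hA : A < 1 - α) (haA : ∀ᶠ m in atTop, a m ≤ A) (j : ℕ) :
    Tendsto (fun m : ℕ => ∫ ω, (rej (critVal α (a m) (b m) m) (p m)
      (firstNulls (I₀ m) j) ω : ℝ) / m ∂(P m)) atTop (𝓝 0) := by
  have h1 := tendstoInProb_zero_iff_integral_abs (P := P) (C := 1)
    (X := fun m ω => (rej (critVal α (a m) (b m) m) (p m) (firstNulls (I₀ m) j) ω : ℝ) / m)
    (by filter_upwards [eventually_ge_atTop 2] with m hm
        have hc := isCritical_critVal (m := m) hα (by omega) (hab m hm)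
        exact (measurable_from_top.comp
          (measurable_rej hc.zero (hBI m hm).measurable _)).div_const _)
    (by filter_upwards [eventually_ge_atTop 2] with m hm ω
        have hc := isCritical_critVal (m := m) hα (by omega) (hab m hm)
        rw [abs_of_nonneg (by positivity)]
        exact div_le_one_of_le₀ (by exact_mod_cast rej_le hc.zero _ ω) (Nat.cast_nonneg _))
  have h2 : ∀ m ω, |(rej (critVal α (a m) (b m) m) (p m) (firstNulls (I₀ m) j) ω : ℝ) / m| =
      (rej (critVal α (a m) (b m) m) (p m) (firstNulls (I₀ m) j) ω : ℝ) / m :=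
    fun m ω => abs_of_nonneg (by positivity)
  simp only [h2] at h1
  rw [← h1]
  intro ε hε
  simp only [sub_zero, h2]
  rw [tendsto_measure_iff_measureReal]
  refine (tendsto_measureReal_le_rej hBI hα hab hA1 hA haA hε j).congr' ?_
  filter_upwards [eventually_gt_atTop 0] with m hm
  congr 1
  ext ω
  have : (0 : ℝ) < m := by exact_mod_cast hm
  exact (le_div_iff₀ this).symm

end Asymptotics

end StepUp

/-! ### Proof of the lemma -/

theorem lemma5p6 {Ω : ℕ → Type*} [∀ m, MeasurableSpace (Ω m)]
    (P : ∀ m, Measure (Ω m)) [∀ m, IsProbabilityMeasure (P m)]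
    (p : ∀ m, Fin m → Ω m → ℝ) (I₀ : ∀ m, Finset (Fin m))
    (hBI : ∀ m, 2 ≤ m → StepUp.BasicIndependence (P m) (p m) (I₀ m))
    (α : ℝ) (hα0 : 0 < α) (hα1 : α < 1)
    (κ₀ : ℝ) (hκ : κ₀ ∈ Set.Ioc (0 : ℝ) 1)
    (hA1 : Tendsto (fun m : ℕ => ((I₀ m).card : ℝ) / (m : ℝ)) atTop (𝓝 κ₀))
    (a b : ℕ → ℝ)
    (hb : Tendsto (fun m : ℕ => b m / (m : ℝ)) atTop (𝓝 0))
    (hab : ∀ m, 2 ≤ m → StepUp.AdmissibleParams α (a m) (b m))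
    (FDP : ∀ m, Ω m → ℝ)
    (hFDP : FDP = fun m ω => StepUp.fdp (StepUp.critVal α (a m) (b m) m) (I₀ m) fun i => p m i ω)
    (R : ℕ → ∀ m, Ω m → ℝ)
    (hR : R = fun j m ω => (StepUp.numRejectionsSubst (StepUp.critVal α (a m) (b m) m) (I₀ m) j
      fun i => p m i ω : ℝ))
    (ζ : ∀ m, Ω m → ℝ)
    (hζ : ζ = fun (m : ℕ) ω => ((m : ℝ) + b m - a m * R 1 m ω) / ((I₀ m).card : ℝ)) :
    (StepUp.TendstoInProb P (fun m ω => FDP m ω - ∫ ω', FDP m ω' ∂(P m)) 0 ↔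
      StepUp.TendstoInProbAtTop P (R 1) ∧
      StepUp.TendstoInProb P (fun m ω => a m / (m : ℝ) * (R 2 m ω - R 1 m ω)) 0 ∧
      StepUp.TendstoInProb P (fun m ω => ζ m ω - ∫ ω', ζ m ω' ∂(P m)) 0) ∧
    (κ₀ = 1 → Tendsto (fun m : ℕ => (I₀ m)ᶜ.card) atTop atTop → limsup a atTop < 1 - α →
      (StepUp.TendstoInProbAtTop P (R 1) →
        StepUp.TendstoInProb P (fun m ω => FDP m ω - ∫ ω', FDP m ω' ∂(P m)) 0) ∧
      Tendsto (fun m : ℕ => ∫ ω, FDP m ω ∂(P m)) atTop (𝓝 α)) := by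
  open StepUp in
  set N : ℕ → ∀ m, Ω m → ℕ := fun j m ω =>
    rej (critVal α (a m) (b m) m) (p m) (firstNulls (I₀ m) j) ω with hN
  have hRN : ∀ j m ω, R j m ω = (N j m ω : ℝ) := fun j m ω => by
    rw [hR]; simp only [numRejectionsSubst_eq, hN]
  have hζN : ∀ m ω, ζ m ω = normDenom (a m) (b m) m (I₀ m).card (N 1 m ω) := fun m ω => by
    rw [hζ]; simp only [hRN, normDenom]
  obtain rfl : ζ = fun m ω => normDenom (a m) (b m) m (I₀ m).card (N 1 m ω) := by
    funext m ω; exact hζN m ω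
  obtain rfl : R = fun j m ω => (N j m ω : ℝ) := by
    funext j m ω; exact hRN j m ω
  clear hR hζ hRN hζN
  subst hFDP
  -- facts that hold for all large `m`
  set K := κ₀⁻¹ + 1 with hKdef
  have hcard := tendsto_card_nulls hκ.1 hA1
  have hden := tendsto_normDenom_zero hκ.1 hA1 hb
  have hlarge : ∀ᶠ m in atTop, 2 ≤ m ∧ 2 ≤ (I₀ m).card ∧ ((m : ℝ) + b m) / (I₀ m).card ≤ K := by
    filter_upwards [eventually_ge_atTop 2, hcard.eventually_ge_atTop 2,
      hden.eventually (ge_mem_nhds (lt_add_one _))] with m h1 h2 h3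
    exact ⟨h1, by exact_mod_cast h2, h3⟩
  have hK0 : 0 < K := by have := hκ.1; positivity
  have hcrit : ∀ m, 2 ≤ m → IsCritical m (critVal α (a m) (b m) m) := fun m hm =>
    isCritical_critVal hα0 (by omega) (hab m hm)
  have hNmeas : ∀ j m, 2 ≤ m → Measurable (N j m) := fun j m hm =>
    measurable_rej (hcrit m hm).zero (hBI m hm).measurable _
  have hNm : ∀ j m, 2 ≤ m → ∀ ω, N j m ω ≤ m := fun j m hm ω => rej_le (hcrit m hm).zero _ ω
  have hN1 : ∀ m, 2 ≤ m → ∀ ω, 1 ≤ N 1 m ω := fun m hm ω =>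
    numRejections_zeroOn_pos (hcrit m hm) _
      (firstNulls_succ_nonempty (j := 0) (Finset.card_pos.2 (hBI m hm).nonempty_trueNulls))
  have hN12 : ∀ m, 2 ≤ m → 2 ≤ (I₀ m).card → ∀ ω, N 1 m ω ≤ N 2 m ω := fun m hm hm2 ω => by
    obtain ⟨-, y, -, hT2⟩ := firstNulls_succ (I₀ m) (j := 1) (by omega)
    refine numRejections_zeroOn_mono (hcrit m hm).zero (fun i => ((hBI m hm).mem_Icc i ω).1) ?_
    rw [hT2]; exact Finset.subset_insert _ _
  have hζb : ∀ᶠ m in atTop, ∀ ω, α ≤ normDenom (a m) (b m) m (I₀ m).card (N 1 m ω) ∧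
      normDenom (a m) (b m) m (I₀ m).card (N 1 m ω) ≤ K := by
    filter_upwards [hlarge] with m hm ω
    exact ⟨le_normDenom (hab m hm.1) hα0 (hNm 1 m hm.1 ω) (by omega) (card_nulls_le _),
      normDenom_le (hab m hm.1) hm.2.2⟩
  -- reformulation of the four conditions by moments
  have eF := tendstoInProb_sub_integral_iff_variance (P := P) (C := 1)
    (X := fun m ω => fdp (critVal α (a m) (b m) m) (I₀ m) fun i => p m i ω)
    (by filter_upwards [eventually_ge_atTop 2] with m hm
        exact measurable_fdp (hcrit m hm).zero (hBI m hm).measurable)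
    (by filter_upwards [eventually_ge_atTop 2] with m hm ω
        have := fdp_mem_Icc (hcrit m hm) (I₀ m) fun i => p m i ω
        rw [abs_of_nonneg this.1]; exact this.2)
  have eA := tendstoInProbAtTop_iff_integral_inv (P := P) (N := N 1)
    (by filter_upwards [eventually_ge_atTop 2] with m hm using hNmeas 1 m hm)
    (by filter_upwards [eventually_ge_atTop 2] with m hm using hN1 m hm)
  have hX : ∀ᶠ m in atTop, ∀ ω, 0 ≤ a m / (m : ℝ) * ((N 2 m ω : ℝ) - N 1 m ω) ∧
      a m / (m : ℝ) * ((N 2 m ω : ℝ) - N 1 m ω) ≤ (N 2 m ω : ℝ) / m := by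
    filter_upwards [hlarge] with m hm ω
    have h1 : (N 1 m ω : ℝ) ≤ N 2 m ω := by exact_mod_cast hN12 m hm.1 hm.2.1 ω
    have h2 := (hab m hm.1).nonneg
    have h3 : a m ≤ 1 := by linarith [(hab m hm.1).le_one_sub]
    refine ⟨mul_nonneg (by positivity) (sub_nonneg.2 h1), ?_⟩
    rw [div_mul_eq_mul_div]
    gcongr
    have h4 : (0 : ℝ) ≤ N 1 m ω := Nat.cast_nonneg _
    nlinarith
  have eB := tendstoInProb_zero_iff_integral_abs (P := P) (C := 1)
    (X := fun m ω => a m / (m : ℝ) * ((N 2 m ω : ℝ) - N 1 m ω))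
    (by filter_upwards [eventually_ge_atTop 2] with m hm
        exact ((measurable_from_top.comp (hNmeas 2 m hm)).sub
          (measurable_from_top.comp (hNmeas 1 m hm))).const_mul _)
    (by filter_upwards [hX, eventually_ge_atTop 2] with m hm hm2 ω
        rw [abs_of_nonneg (hm ω).1]
        exact (hm ω).2.trans (div_le_one_of_le₀ (by exact_mod_cast hNm 2 m hm2 ω)
          (Nat.cast_nonneg _)))
  have eB' : Tendsto (fun m : ℕ => ∫ ω, |a m / (m : ℝ) * ((N 2 m ω : ℝ) - N 1 m ω)| ∂(P m))
      atTop (𝓝 0) ↔ Tendsto (fun m : ℕ => ∫ ω, a m / (m : ℝ) * ((N 2 m ω : ℝ) - N 1 m ω) ∂(P m))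
      atTop (𝓝 0) := by
    refine tendsto_congr' ?_
    filter_upwards [hX] with m hm
    exact integral_congr_ae (ae_of_all _ fun ω => abs_of_nonneg (hm ω).1)
  rw [eB'] at eB
  have hζmeas : ∀ m, 2 ≤ m →
      Measurable fun ω => normDenom (a m) (b m) m (I₀ m).card (N 1 m ω) := fun m hm =>
    measurable_from_top (f := fun r => normDenom (a m) (b m) m (I₀ m).card r) |>.comp
      (hNmeas 1 m hm)
  have eC := tendstoInProb_sub_integral_iff_variance (P := P) (C := K)
    (X := fun m ω => normDenom (a m) (b m) m (I₀ m).card (N 1 m ω))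
    (by filter_upwards [eventually_ge_atTop 2] with m hm using hζmeas m hm)
    (by filter_upwards [hζb] with m hm ω
        rw [abs_of_nonneg (hα0.le.trans (hm ω).1)]; exact (hm ω).2)
  have hbounds := hlarge.mono fun m hm =>
    (hBI m hm.1).variance_fdp_bounds hα0 (hab m hm.1) hm.2.1 hm.2.2 rfl rfl rfl rfl
  have hinv : Tendsto (fun m => ((I₀ m).card : ℝ)⁻¹) atTop (𝓝 0) := hcard.inv_tendsto_atTop
  have hpartA : Tendsto (fun m => Var[fun ω => fdp (critVal α (a m) (b m) m) (I₀ m)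
        fun i => p m i ω; P m]) atTop (𝓝 0) ↔
      Tendsto (fun m => ∫ ω, (N 1 m ω : ℝ)⁻¹ ∂(P m)) atTop (𝓝 0) ∧
      Tendsto (fun m : ℕ => ∫ ω, a m / (m : ℝ) * ((N 2 m ω : ℝ) - N 1 m ω) ∂(P m)) atTop (𝓝 0) ∧
      Tendsto (fun m => Var[fun ω => normDenom (a m) (b m) m (I₀ m).card (N 1 m ω); P m])
        atTop (𝓝 0) := by
    constructor
    · intro h
      have hlim : ∀ c : ℝ, Tendsto (fun m => c * (Var[fun ω => fdp (critVal α (a m) (b m) m) (I₀ m)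
          fun i => p m i ω; P m] + ((I₀ m).card : ℝ)⁻¹)) atTop (𝓝 0) := fun c => by
        simpa using (h.add hinv).const_mul c
      refine ⟨squeeze_zero' (Eventually.of_forall fun m => integral_nonneg fun ω => by positivity)
          (hbounds.mono fun m hm => hm.2.1) (hlim _),
        squeeze_zero' (hX.mono fun m hm => integral_nonneg fun ω => (hm ω).1)
          (hbounds.mono fun m hm => hm.2.2.1) (hlim _),
        squeeze_zero' (Eventually.of_forall fun m => variance_nonneg _ _)
          (hbounds.mono fun m hm => hm.2.2.2) (hlim _)⟩
    · rintro ⟨h1, h2, h3⟩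
      have h4 := (h1.add (h2.const_mul (2 * K * α⁻¹))).add (h3.const_mul (α⁻¹ ^ 2))
      simp only [mul_zero, add_zero] at h4
      exact squeeze_zero' (Eventually.of_forall fun m => variance_nonneg _ _)
        (hbounds.mono fun m hm => hm.1) h4
  beta_reduce
  refine ⟨by rw [eF, eA, eB, eC]; exact hpartA, ?_⟩
  rintro rfl - hlim
  -- only a vanishing fraction of hypotheses is rejected
  obtain ⟨A, hA, hA'⟩ := exists_between hlim
  have haA : ∀ᶠ m in atTop, a m ≤ A := by
    refine (eventually_lt_of_limsup_lt hA ?_).mono fun m hm => hm.le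
    -- Admissibility supplies the upper bound on `a` without which the `limsup` would carry no
    -- information.
    exact ⟨1 - α, eventually_map.2 ((eventually_ge_atTop 2).mono fun m hm =>
      (hab m hm).le_one_sub)⟩
  have hdiv := tendsto_integral_rej_div hBI hα0 hab hA1 hA' haA
  rw [inv_one] at hden
  have hNint : ∀ j m, 2 ≤ m → ∀ g : ℕ → ℝ, Integrable (fun ω => g (N j m ω)) (P m) :=
    fun j m hm g => integrable_rej (hcrit m hm).zero (hBI m hm).measurable _ g
  -- The deviation of `ζ_1` from `1` splits into a deterministic part, vanishing since `κ₀ = 1`, and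
  -- a part controlled by the fraction of rejections.
  have hdev : ∀ᶠ m in atTop, ∀ ω, |normDenom (a m) (b m) m (I₀ m).card (N 1 m ω) - 1| ≤
      |((m : ℝ) + b m) / (I₀ m).card - 1| + K * ((N 1 m ω : ℝ) / m) := by
    filter_upwards [hlarge] with m hm ω
    have hm0 : (0 : ℝ) < (I₀ m).card := by exact_mod_cast (by omega : 0 < (I₀ m).card)
    have hm' : (0 : ℝ) < m := by exact_mod_cast (by omega : 0 < m)
    have h1 : normDenom (a m) (b m) m (I₀ m).card (N 1 m ω) - 1 =
        (((m : ℝ) + b m) / (I₀ m).card - 1) -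
          (m : ℝ) / (I₀ m).card * (a m * ((N 1 m ω : ℝ) / m)) := by
      unfold normDenom; field_simp; ring
    have h2 := (hab m hm.1).nonneg
    have h3 : a m ≤ 1 := by linarith [(hab m hm.1).le_one_sub]
    have hmK : (m : ℝ) / (I₀ m).card ≤ K := le_trans (by
      gcongr; linarith [(hab m hm.1).nonneg_right]) hm.2.2
    rw [h1]
    refine (abs_sub _ _).trans (add_le_add le_rfl ?_)
    rw [abs_of_nonneg (by positivity)]
    have h4 : 0 ≤ (N 1 m ω : ℝ) / m := by positivity
    exact mul_le_mul hmK (mul_le_of_le_one_left h4 h3) (by positivity) hK0.le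
  have hL1 : Tendsto (fun m => ∫ ω, |normDenom (a m) (b m) m (I₀ m).card (N 1 m ω) - 1| ∂(P m))
      atTop (𝓝 0) := by
    have h1 := ((hden.sub_const 1).abs).add ((hdiv 1).const_mul K)
    simp only [sub_self, abs_zero, mul_zero, add_zero] at h1
    refine squeeze_zero' (Eventually.of_forall fun m => integral_nonneg fun ω => abs_nonneg _)
      ?_ h1
    filter_upwards [hdev, eventually_ge_atTop 2] with m hm hm2
    have hi : Integrable (fun ω => K * ((N 1 m ω : ℝ) / m)) (P m) :=
      hNint 1 m hm2 fun r => K * ((r : ℝ) / m)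
    have h2 := integral_mono (hNint 1 m hm2 fun r => |normDenom (a m) (b m) m (I₀ m).card r - 1|)
      ((integrable_const _).add hi) hm
    rw [integral_add' (integrable_const _) hi, integral_const, probReal_univ, one_smul,
      integral_const_mul] at h2
    exact h2
  constructor
  · rw [eF, eA]
    refine fun h1 => hpartA.2 ⟨h1, ?_, ?_⟩
    -- The second condition follows from `(a/m)(R_2 - R_1) ≤ R_2/m`.
    · refine squeeze_zero' (hX.mono fun m hm => integral_nonneg fun ω => (hm ω).1) ?_ (hdiv 2)
      filter_upwards [hX, eventually_ge_atTop 2] with m hm hm2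
      exact integral_mono (((hNint 2 m hm2 fun r => (r : ℝ)).sub
        (hNint 1 m hm2 fun r => (r : ℝ))).const_mul _) (hNint 2 m hm2 fun r => (r : ℝ) / m)
        fun ω => (hm ω).2
    · have h2 := hL1.const_mul (K + 1)
      rw [mul_zero] at h2
      refine squeeze_zero' (Eventually.of_forall fun m => variance_nonneg _ _) ?_ h2
      filter_upwards [hζb, eventually_ge_atTop 2] with m hm hm2
      -- The third condition: the variance is at most `E (ζ_1 - 1)²`, and one factor `|ζ_1 - 1|` is
      -- bounded by `K + 1`.
      rw [← variance_sub_const (hζmeas m hm2).aestronglyMeasurable 1, ← integral_const_mul]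
      refine (variance_le_expectation_sq
        ((hζmeas m hm2).sub_const 1).aestronglyMeasurable).trans ?_
      refine integral_mono (hNint 1 m hm2 fun r => (normDenom (a m) (b m) m (I₀ m).card r - 1) ^ 2)
        (hNint 1 m hm2 fun r => (K + 1) * |normDenom (a m) (b m) m (I₀ m).card r - 1|) fun ω => ?_
      simp only [Pi.pow_apply]
      rw [← sq_abs, pow_two]
      refine mul_le_mul_of_nonneg_right ?_ (abs_nonneg _)
      rw [abs_le]
      constructor <;> linarith [(hm ω).1, (hm ω).2]
  · rw [tendsto_iff_dist_tendsto_zero]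
    refine squeeze_zero' (Eventually.of_forall fun m => dist_nonneg) ?_ hL1
    filter_upwards [hζb, eventually_ge_atTop 2] with m hm hm2
    rw [(hBI m hm2).integral_fdp hα0 (hab m hm2), Real.dist_eq]
    have h1 : α * (∫ ω, (normDenom (a m) (b m) m (I₀ m).card (N 1 m ω))⁻¹ ∂(P m)) - α =
        ∫ ω, (α * (normDenom (a m) (b m) m (I₀ m).card (N 1 m ω))⁻¹ - α) ∂(P m) := by
      rw [integral_sub ((hNint 1 m hm2 fun r =>
        (normDenom (a m) (b m) m (I₀ m).card r)⁻¹).const_mul α) (integrable_const _),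
        integral_const_mul, integral_const, probReal_univ, one_smul]
    refine (congrArg _ h1).trans_le (abs_integral_le_integral_abs.trans ?_)
    refine integral_mono (hNint 1 m hm2 fun r =>
      |α * (normDenom (a m) (b m) m (I₀ m).card r)⁻¹ - α|)
      (hNint 1 m hm2 fun r => |normDenom (a m) (b m) m (I₀ m).card r - 1|) fun ω => ?_
    have hz := hα0.trans_le (hm ω).1
    have h2 : α * (normDenom (a m) (b m) m (I₀ m).card (N 1 m ω))⁻¹ - α =
        α / normDenom (a m) (b m) m (I₀ m).card (N 1 m ω) *
          (1 - normDenom (a m) (b m) m (I₀ m).card (N 1 m ω)) := by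
      field_simp
    simp only
    -- Since `ζ_1 ≥ α`, the factor `α / ζ_1` is at most `1`.
    rw [h2, abs_mul, abs_sub_comm, abs_of_pos (div_pos hα0 hz)]
    exact mul_le_of_le_one_left (abs_nonneg _) ((div_le_one hz).2 (hm ω).1)
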